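/- All Hilbert spaces are complex and separable. A state on a Hilbert space $\mathcal{H}$ is a positive trace-class operator on $\mathcal{H}$ with unit trace; $\mathfrak{S}(\mathcal{H})$ is the set of all states. For a state $\rho$ let $\{\lambda^{\rho}_i\}_{i\ge 1}$ be the non-increasing sequence of its positive eigenvalues, repeated according to multiplicity and continued by zeros if it is finite. The state $\rho$ has the FA-property if there is a sequence $\{g_i\}_{i\ge1}$ of nonnegative numbers such that $$\sum_{i=1}^{+\infty}\lambda^{\rho}_i g_i<+\infty\qquad\text{and}\qquad \lim_{\beta\to0^+}\Big[\sum_{i=1}^{+\infty}e^{-\beta g_i}\Big]^{\beta}=1 .$$ Let $\mathfrak{S}_{\mathsf{FA}}(\mathcal{H})$ be the set of all states in $\mathfrak{S}(\mathcal{H})$ that have the FA-property. (A) For every Hilbert space $\mathcal{H}$ the set $\mathfrak{S}_{\mathsf{FA}}(\mathcal{H})$ is convex. (B) Let $\mathcal{H}_1,\dots,\mathcal{H}_n$ be Hilbert spaces and let $\mathcal{H}_1\otimes\dots\otimes\mathcal{H}_n$ be their Hilbert space tensor product. If $\rho_{1\dots n}$ is a state in $\mathfrak{S}(\mathcal{H}_1\otimes\dots\otimes\mathcal{H}_n)$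 such that, for all $k=1,\dots,n$, its marginal state $\rho_k$ on $\mathcal{H}_k$ (the partial trace of $\rho_{1\dots n}$ over all the other factors) belongs to $\mathfrak{S}_{\mathsf{FA}}(\mathcal{H}_k)$, then $\rho_{1\dots n}\in\mathfrak{S}_{\mathsf{FA}}(\mathcal{H}_1\otimes\dots\otimes\mathcal{H}_n)$. Moreover, for any states $\rho_k\in\mathfrak{S}(\mathcal{H}_k)$, $k=1,\dots,n$, the state $\rho_1\otimes\dots\otimes\rho_n$ belongs to $\mathfrak{S}_{\mathsf{FA}}(\mathcal{H}_1\otimes\dots\otimes\mathcal{H}_n)$ if and only if $\rho_k\in\mathfrak{S}_{\mathsf{FA}}(\mathcal{H}_k)$ for all $k=1,\dots,n$. -/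

import Mathlib

open Filter Topology InnerProductSpace
open scoped ENNReal

universe u

noncomputable section

namespace QState

/-! ## Quantum states, eigenvalue sequences and the FA-property -/

section States

variable {H : Type u} [NormedAddCommGroup H] [InnerProductSpace ℂ H] [CompleteSpace H]

/-- A quantum state on a Hilbert space: a positive bounded operator which is of trace class and
has unit trace, that is, whose diagonal sums to `1` in every orthonormal basis. -/
def IsState (ρ : H →L[ℂ] H) : Prop :=
  ρ.IsPositive ∧
    ∀ (κ : Type u) (b : HilbertBasis κ ℂ H), HasSum (fun j => ⟪b j, ρ (b j)⟫_ℂ) 1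

/-- `l` is the non-increasing sequence of eigenvalues of the positive operator `ρ`, each positive
eigenvalue being repeated according to its multiplicity. If there are only finitely many positive
eigenvalues then the sequence is continued by zeros. -/
def IsEigenvalueSequence (ρ : H →L[ℂ] H) (l : ℕ → ℝ) : Prop :=
  Antitone l ∧ (∀ i, 0 ≤ l i) ∧
    ∀ μ : ℝ, 0 < μ →
      {i : ℕ | l i = μ}.encard =
        Cardinal.toENat (Module.rank ℂ (Module.End.eigenspace (ρ : H →ₗ[ℂ] H) (μ : ℂ)))

/-- The FA-property: there are numbers `g i ≥ 0` such that `∑ i, l i * g i < ∞` for the sequence `l`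
of eigenvalues of `ρ`, and `(∑ i, exp (-β * g i)) ^ β → 1` as `β → 0+`. The second series is a sum
in `[0, ∞]`. -/
def HasFAProperty (ρ : H →L[ℂ] H) : Prop :=
  ∃ l : ℕ → ℝ, IsEigenvalueSequence ρ l ∧
    ∃ g : ℕ → ℝ, (∀ i, 0 ≤ g i) ∧ Summable (fun i => l i * g i) ∧
      Tendsto (fun β : ℝ => (∑' i, ENNReal.ofReal (Real.exp (-β * g i))) ^ β) (𝓝[>] 0) (𝓝 1)

variable (H) in
/-- The set of all states on `H` that have the FA-property. -/
def FAStates : Set (H →L[ℂ] H) := {ρ | IsState ρ ∧ HasFAProperty ρ}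

end States

/-! ## The Hilbert space tensor product of finitely many Hilbert spaces -/

section Kernels

open scoped ComplexOrder

variable {𝕜 : Type*} [RCLike 𝕜]

theorem posSemidef_gram' {X E : Type*} [NormedAddCommGroup E] [InnerProductSpace 𝕜 E]
    (v : X → E) : (Matrix.gram 𝕜 v).PosSemidef := by
  refine ⟨Matrix.isHermitian_gram 𝕜 v, fun c => ?_⟩
  have : (c.sum fun i xi => c.sum fun j xj => star xi * Matrix.gram 𝕜 v i j * xj)
      = ⟪c.sum fun i a => a • v i, c.sum fun i a => a • v i⟫_𝕜 := by
    simp only [Finsupp.sum, sum_inner, inner_sum, inner_smul_left, inner_smul_right,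
      Matrix.gram_apply, RCLike.star_def, Finset.mul_sum]
    rw [Finset.sum_comm]
    refine Finset.sum_congr rfl fun i _ => Finset.sum_congr rfl fun j _ => by ring
  rw [this, inner_self_eq_norm_sq_to_K]
  exact RCLike.ofReal_nonneg.2 (norm_nonneg _) |> fun h => pow_nonneg h 2

/-- A finite product of positive semidefinite kernels is positive semidefinite. -/
theorem posSemidef_prod {X κ : Type*} (s : Finset κ) (P : κ → Matrix X X 𝕜)
    (hP : ∀ i ∈ s, (P i).PosSemidef) :
    (Matrix.of fun x y => ∏ i ∈ s, P i x y).PosSemidef := by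
  classical
  induction s using Finset.induction_on with
  | empty =>
    have := posSemidef_gram' (𝕜 := 𝕜) (fun _ : X => (1 : 𝕜))
    convert this using 1
    ext x y
    simp [Matrix.gram_apply]
  | insert a s ha ih =>
    have h1 := (hP a (Finset.mem_insert_self a s)).hadamard
      (ih fun i hi => hP i (Finset.mem_insert_of_mem hi))
    convert h1 using 1
    ext x y
    simp [Finset.prod_insert ha]

/-- If `P i` and `Q i - P i` are positive semidefinite for all `i`, so is `∏ Q i - ∏ P i`. -/
theorem posSemidef_prod_sub {X κ : Type*} (s : Finset κ) (P Q : κ → Matrix X X 𝕜)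
    (hP : ∀ i ∈ s, (P i).PosSemidef) (hQP : ∀ i ∈ s, (Q i - P i).PosSemidef) :
    (Matrix.of fun x y => ∏ i ∈ s, Q i x y - ∏ i ∈ s, P i x y).PosSemidef := by
  classical
  induction s using Finset.induction_on with
  | empty =>
    convert (Matrix.PosSemidef.zero : (0 : Matrix X X 𝕜).PosSemidef) using 1
    ext x y
    simp
  | insert a s ha ih =>
    have hPs := posSemidef_prod s P fun i hi => hP i (Finset.mem_insert_of_mem hi)
    have ihs := ih (fun i hi => hP i (Finset.mem_insert_of_mem hi))
      (fun i hi => hQP i (Finset.mem_insert_of_mem hi))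
    have hQa : (Q a).PosSemidef := by
      have := (hP a (Finset.mem_insert_self a s)).add (hQP a (Finset.mem_insert_self a s))
      simpa using this
    have h := (hQa.hadamard ihs).add ((hQP a (Finset.mem_insert_self a s)).hadamard hPs)
    convert h using 1
    ext x y
    simp only [Finset.prod_insert ha, Matrix.of_apply, Matrix.add_apply, Matrix.hadamard_apply,
      Matrix.sub_apply]
    ring

variable {ι : Type} [Fintype ι] {H : ι → Type*} [∀ i, NormedAddCommGroup (H i)]
  [∀ i, InnerProductSpace 𝕜 (H i)]

theorem re_sum_prod_inner_nonneg (f : (∀ i, H i) →₀ 𝕜) :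
    0 ≤ RCLike.re (f.sum fun x a => f.sum fun y b => star a * (∏ i, ⟪x i, y i⟫_𝕜) * b) :=
  (RCLike.nonneg_iff.mp ((posSemidef_prod Finset.univ
    (fun i => Matrix.gram 𝕜 fun x : ∀ i, H i => x i) fun _ _ => posSemidef_gram' _).2 f)).1

theorem re_sum_prod_inner_map_le {H' : ι → Type*} [∀ i, NormedAddCommGroup (H' i)]
    [∀ i, InnerProductSpace 𝕜 (H' i)] (A : ∀ i, H i →L[𝕜] H' i) (f : (∀ i, H i) →₀ 𝕜) :
    RCLike.re (f.sum fun x a => f.sum fun y b =>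
        star a * (∏ i, ⟪A i (x i), A i (y i)⟫_𝕜) * b) ≤
      (∏ i, ‖A i‖) ^ 2 *
        RCLike.re (f.sum fun x a => f.sum fun y b => star a * (∏ i, ⟪x i, y i⟫_𝕜) * b) := by
  have h := (RCLike.nonneg_iff.mp ((posSemidef_prod_sub Finset.univ
    (fun i => Matrix.gram 𝕜 fun x : ∀ i, H i => A i (x i))
    (fun i => ‖A i‖ ^ 2 • Matrix.gram 𝕜 fun x : ∀ i, H i => x i)
    (fun _ _ => posSemidef_gram' _)
    fun i _ => Matrix.posSemidef_opNorm_smul_gram_sub_gram (fun x : ∀ i, H i => x i) (A i)).2 f)).1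
  simp only [Matrix.of_apply, Matrix.smul_apply, Matrix.gram_apply, Finset.prod_smul,
    Finsupp.sum, mul_sub, sub_mul, Finset.sum_sub_distrib, map_sub, sub_nonneg,
    Algebra.mul_smul_comm, Algebra.smul_mul_assoc, ← Finset.smul_sum, RCLike.smul_re,
    Finset.prod_pow] at h
  simpa only [Finsupp.sum] using h

end Kernels

section Tensor

variable {ι : Type} [Fintype ι] (H : ι → Type u)

section Construction

variable [∀ i, NormedAddCommGroup (H i)] [∀ i, InnerProductSpace ℂ (H i)]

/-- The kernel `(x, y) ↦ ∏ i, ⟪x i, y i⟫`, the inner product of two elementary tensors. -/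
def tensorKernel (x y : ∀ i, H i) : ℂ := ∏ i, ⟪x i, y i⟫_ℂ

/-- Formal linear combinations of elementary tensors `⊗ x i`, where `x` runs over `∏ H i`. -/
abbrev PreTensor : Type u := (∀ i, H i) →₀ ℂ

/-- The semi-inner product on formal linear combinations which extends
`⟪⊗ x i, ⊗ y i⟫ = ∏ i, ⟪x i, y i⟫` sesquilinearly. -/
instance : PreInnerProductSpace.Core ℂ (PreTensor H) where
  inner f g := Finsupp.sum f fun x a => Finsupp.sum g fun y b => star a * tensorKernel H x y * b
  conj_inner_symm f g := by
    rw [Finsupp.sum_comm]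
    simp only [map_finsuppSum]
    refine Finsupp.sum_congr fun x _ => Finsupp.sum_congr fun y _ => ?_
    simp only [tensorKernel, map_mul, map_prod, inner_conj_symm, RCLike.star_def,
      RCLike.conj_conj]
    ring
  add_left f g h := by
    refine Finsupp.sum_add_index' (by simp) fun x a b => ?_
    simp [← Finsupp.sum_add, add_mul]
  smul_left f g r := by
    refine (Finsupp.sum_smul_index (by simp)).trans ?_
    simp [Finsupp.mul_sum, ← mul_assoc]
  re_inner_nonneg f := re_sum_prod_inner_nonneg f

instance : SeminormedAddCommGroup (PreTensor H) :=
  InnerProductSpace.Core.toSeminormedAddCommGroup (𝕜 := ℂ)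

instance : InnerProductSpace ℂ (PreTensor H) := .ofCore _

/-- The Hilbert space tensor product `⨂ i, H i`: the Hausdorff completion of the space of
formal linear combinations of elementary tensors with respect to the semi-inner product that is
determined by `⟪⊗ x i, ⊗ y i⟫ = ∏ i, ⟪x i, y i⟫`. -/
abbrev HilbertTensor : Type u := UniformSpace.Completion (PreTensor H)

variable {H}

theorem preTensor_inner_def (f g : PreTensor H) :
    ⟪f, g⟫_ℂ =
      Finsupp.sum f fun x a => Finsupp.sum g fun y b => star a * tensorKernel H x y * b := rfl

/-- The elementary tensor `⊗ x i` as a formal linear combination. -/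
def preTensorMk (x : ∀ i, H i) : PreTensor H := Finsupp.single x 1

theorem inner_preTensorMk_left (x : ∀ i, H i) (g : PreTensor H) :
    ⟪preTensorMk x, g⟫_ℂ = Finsupp.sum g fun y b => tensorKernel H x y * b := by
  rw [preTensor_inner_def, preTensorMk, Finsupp.sum_single_index] <;> simp

theorem inner_preTensorMk (x y : ∀ i, H i) :
    ⟪preTensorMk x, preTensorMk y⟫_ℂ = ∏ i, ⟪x i, y i⟫_ℂ := by
  rw [inner_preTensorMk_left, preTensorMk, Finsupp.sum_single_index] <;> simp [tensorKernel]

theorem inner_preTensorMk_right (g : PreTensor H) (x : ∀ i, H i) :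
    ⟪g, preTensorMk x⟫_ℂ = Finsupp.sum g fun y b => star b * tensorKernel H y x := by
  rw [preTensor_inner_def]
  refine Finsupp.sum_congr fun y _ => ?_
  rw [preTensorMk, Finsupp.sum_single_index] <;> simp

/-- The elementary tensor `⊗ x i` as an element of the Hilbert space tensor product. It is a
continuous multilinear function of `x`. -/
def tprod : ContinuousMultilinearMap ℂ H (HilbertTensor H) :=
  MultilinearMap.mkContinuous
    { toFun := fun x => ((preTensorMk x : PreTensor H) : HilbertTensor H)
      map_update_add' := by
        intro _ m i x y
        refine UniformSpace.Completion.denseRange_coe.eq_of_inner_left ℂ fun f => ?_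
        simp only [inner_add_left, UniformSpace.Completion.inner_coe, inner_preTensorMk_left,
          ← Finsupp.sum_add]
        refine Finsupp.sum_congr fun z _ => ?_
        rw [← add_mul]
        congr 1
        simp only [tensorKernel]
        rw [← Finset.mul_prod_erase _ _ (Finset.mem_univ i),
          ← Finset.mul_prod_erase _ _ (Finset.mem_univ i),
          ← Finset.mul_prod_erase _ _ (Finset.mem_univ i)]
        simp only [Function.update_self, inner_add_left, add_mul]
        congr 2 <;>
        exact Finset.prod_congr rfl fun j hj => by
          simp [Function.update_of_ne (Finset.ne_of_mem_erase hj)]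
      map_update_smul' := by
        intro _ m i c x
        refine UniformSpace.Completion.denseRange_coe.eq_of_inner_left ℂ fun f => ?_
        simp only [inner_smul_left, UniformSpace.Completion.inner_coe, inner_preTensorMk_left,
          Finsupp.mul_sum]
        refine Finsupp.sum_congr fun z _ => ?_
        rw [← mul_assoc]
        congr 1
        simp only [tensorKernel]
        rw [← Finset.mul_prod_erase _ _ (Finset.mem_univ i),
          ← Finset.mul_prod_erase _ _ (Finset.mem_univ i)]
        simp only [Function.update_self, inner_smul_left, mul_assoc]
        congr 2
        exact Finset.prod_congr rfl fun j hj => by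
          simp [Function.update_of_ne (Finset.ne_of_mem_erase hj)] }
    1 (by
      intro x
      rw [← sq_le_sq₀ (norm_nonneg _) (by positivity), one_mul, ← Finset.prod_pow]
      change ‖((preTensorMk x : PreTensor H) : HilbertTensor H)‖ ^ 2 ≤ _
      rw [UniformSpace.Completion.norm_coe, ← inner_self_eq_norm_sq (𝕜 := ℂ), inner_preTensorMk]
      refine le_of_eq ?_
      simp only [inner_self_eq_norm_sq_to_K]
      norm_cast)

theorem tprod_apply (x : ∀ i, H i) :
    tprod x = ((preTensorMk x : PreTensor H) : HilbertTensor H) := rfl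

theorem inner_tprod (x y : ∀ i, H i) : ⟪tprod x, tprod y⟫_ℂ = ∏ i, ⟪x i, y i⟫_ℂ := by
  rw [tprod_apply, tprod_apply, UniformSpace.Completion.inner_coe, inner_preTensorMk]

/-- The linear combinations of elementary tensors are dense. -/
theorem dense_span_tprod :
    Dense (Submodule.span ℂ (Set.range (tprod (H := H))) : Set (HilbertTensor H)) := by
  refine (UniformSpace.Completion.denseRange_coe (α := PreTensor H)).mono ?_
  rintro _ ⟨f, rfl⟩
  induction f using Finsupp.induction_linear with
  | zero => exact Submodule.zero_mem _
  | add f g hf hg =>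
    rw [UniformSpace.Completion.coe_add]
    exact Submodule.add_mem _ hf hg
  | single x a =>
    have h : (Finsupp.single x a : PreTensor H) = a • preTensorMk x := by simp [preTensorMk]
    rw [h, UniformSpace.Completion.coe_smul]
    exact Submodule.smul_mem _ _ (Submodule.subset_span ⟨x, rfl⟩)

/-- The linear map `⊗ x i ↦ ⊗ A i (x i)` on formal linear combinations. -/
def preTensorMap (A : ∀ i, H i →L[ℂ] H i) : PreTensor H →L[ℂ] PreTensor H :=
  LinearMap.mkContinuous (Finsupp.lmapDomain ℂ ℂ fun (x : ∀ i, H i) i => A i (x i))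
    (∏ i, ‖A i‖) (by
      intro f
      have h0 : 0 ≤ ∏ i, ‖A i‖ := Finset.prod_nonneg fun _ _ => norm_nonneg _
      rw [← sq_le_sq₀ (norm_nonneg _) (mul_nonneg h0 (norm_nonneg _)), mul_pow,
        ← inner_self_eq_norm_sq (𝕜 := ℂ), ← inner_self_eq_norm_sq (𝕜 := ℂ)]
      refine le_trans (le_of_eq ?_) (re_sum_prod_inner_map_le A f)
      rw [preTensor_inner_def, Finsupp.lmapDomain_apply,
        Finsupp.sum_mapDomain_index (by simp) (by
          intro x a b
          simp [← Finsupp.sum_add, add_mul])]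
      congr 1
      refine Finsupp.sum_congr fun x _ => ?_
      rw [Finsupp.sum_mapDomain_index (by simp) (by intro y a b; ring)]
      rfl)

/-- The tensor product `⨂ i, A i` of bounded operators, the bounded operator on `⨂ i, H i` with
`(⨂ i, A i) (⊗ x i) = ⊗ A i (x i)`. -/
def tensorOp (A : ∀ i, H i →L[ℂ] H i) : HilbertTensor H →L[ℂ] HilbertTensor H :=
  (preTensorMap A).completion

theorem tensorOp_tprod (A : ∀ i, H i →L[ℂ] H i) (x : ∀ i, H i) :
    tensorOp A (tprod x) = tprod fun i => A i (x i) := by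
  rw [tprod_apply, tprod_apply, tensorOp, ContinuousLinearMap.completion_apply_coe]
  congr 1
  simp [preTensorMap, preTensorMk]

end Construction

section Marginals

variable [∀ i, NormedAddCommGroup (H i)] [∀ i, InnerProductSpace ℂ (H i)]
  [∀ i, CompleteSpace (H i)]

/-- A fixed orthonormal basis of a Hilbert space. -/
def stdBasis (E : Type u) [NormedAddCommGroup E] [InnerProductSpace ℂ E] [CompleteSpace E] :
    HilbertBasis (exists_hilbertBasis ℂ E).choose ℂ E :=
  (exists_hilbertBasis ℂ E).choose_spec.choose

/-- The index set of `stdBasis E`. -/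
abbrev StdIndex (E : Type u) [NormedAddCommGroup E] [InnerProductSpace ℂ E] [CompleteSpace E] :
    Type u := (exists_hilbertBasis ℂ E).choose

variable {H}

theorem orthonormal_tprod {κ : ι → Type*} (b : ∀ i, HilbertBasis (κ i) ℂ (H i)) :
    Orthonormal ℂ (fun f : ∀ i, κ i => tprod fun i => b i (f i)) := by
  classical
  rw [orthonormal_iff_ite]
  intro f g
  rw [inner_tprod]
  split_ifs with h
  · subst h
    refine Finset.prod_eq_one fun i _ => ?_
    simpa using (orthonormal_iff_ite.1 (b i).orthonormal) (f i) (f i)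
  · obtain ⟨i, hi⟩ := Function.ne_iff.1 h
    refine Finset.prod_eq_zero (Finset.mem_univ i) ?_
    rw [(orthonormal_iff_ite.1 (b i).orthonormal), if_neg hi]

theorem eq_zero_of_inner_tprod {κ : ι → Type*} (b : ∀ i, HilbertBasis (κ i) ℂ (H i))
    (v : HilbertTensor H) (hv : ∀ f : ∀ i, κ i, ⟪v, tprod fun i => b i (f i)⟫_ℂ = 0) : v = 0 := by
  classical
  have key : ∀ s : Finset ι, ∀ x : ∀ i, H i, (∀ i ∉ s, ∃ j, x i = b i j) →
      ⟪v, tprod x⟫_ℂ = 0 := by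
    intro s
    induction s using Finset.induction_on with
    | empty =>
      intro x hx
      choose f hf using fun i => hx i (by simp)
      rw [show x = fun i => b i (f i) from funext hf]
      exact hv f
    | insert a s ha ih =>
      intro x hx
      let L : H a →L[ℂ] ℂ := (innerSL ℂ v) ∘L (tprod.toContinuousLinearMap x a)
      have hL : L = 0 := by
        refine ContinuousLinearMap.ext_on
          (Submodule.dense_iff_topologicalClosure_eq_top.2 (b a).dense_span) ?_
        rintro _ ⟨j, rfl⟩
        refine ih _ fun i hi => ?_
        by_cases hia : i = a
        · subst hia; exact ⟨j, by simp⟩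
        · obtain ⟨j', hj'⟩ := hx i (by simp [hia, hi])
          exact ⟨j', by simp [hia, hj']⟩
      have := congrArg (fun T => T (x a)) hL
      simpa [L] using this
  have h0 : innerSL ℂ v = 0 := by
    refine ContinuousLinearMap.ext_on dense_span_tprod ?_
    rintro _ ⟨x, rfl⟩
    exact key Finset.univ x (by simp)
  have := congrArg (fun T => T v) h0
  simpa using this

/-- Elementary tensors of orthonormal basis vectors form an orthonormal basis. -/
def tensorBasis {κ : ι → Type*} (b : ∀ i, HilbertBasis (κ i) ℂ (H i)) :
    HilbertBasis (∀ i, κ i) ℂ (HilbertTensor H) :=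
  HilbertBasis.mkOfOrthogonalEqBot (orthonormal_tprod b) (by
    rw [Submodule.eq_bot_iff]
    intro v hv
    refine eq_zero_of_inner_tprod b v fun f => ?_
    exact Submodule.mem_orthogonal' _ _ |>.1 hv _ (Submodule.subset_span ⟨f, rfl⟩))

/-- A bounded operator of Hilbert--Schmidt type is bounded by its Hilbert--Schmidt norm. -/
theorem opNorm_sq_le {E F κ : Type*} [NormedAddCommGroup E] [InnerProductSpace ℂ E]
    [NormedAddCommGroup F] [InnerProductSpace ℂ F]
    (b : HilbertBasis κ ℂ E) (S : E →L[ℂ] F) (hS : Summable fun j => ‖S (b j)‖ ^ 2) :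
    ‖S‖ ^ 2 ≤ ∑' j, ‖S (b j)‖ ^ 2 := by
  have h0 : 0 ≤ ∑' j, ‖S (b j)‖ ^ 2 := tsum_nonneg fun _ => sq_nonneg _
  refine Real.le_sqrt (norm_nonneg _) h0 |>.1 ?_
  refine S.opNorm_le_bound (Real.sqrt_nonneg _) fun x => ?_
  have hx : HasSum (fun j => (b.repr x j) • S (b j)) (S x) := by
    simpa using (b.hasSum_repr x).mapL S
  refine le_of_tendsto hx.norm (Eventually.of_forall fun s => ?_)
  have h1 : ∑ j ∈ s, ‖b.repr x j‖ ^ 2 ≤ ‖x‖ ^ 2 := by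
    have := b.orthonormal.sum_inner_products_le x (s := s)
    simpa [b.repr_apply_apply] using this
  calc ‖∑ j ∈ s, b.repr x j • S (b j)‖ ≤ ∑ j ∈ s, ‖S (b j)‖ * ‖b.repr x j‖ := by
        refine (norm_sum_le _ _).trans (le_of_eq ?_)
        exact Finset.sum_congr rfl fun j _ => by rw [norm_smul, mul_comm]
    _ ≤ √(∑ j ∈ s, ‖S (b j)‖ ^ 2) * √(∑ j ∈ s, ‖b.repr x j‖ ^ 2) :=
        Real.sum_mul_le_sqrt_mul_sqrt _ _ _
    _ ≤ √(∑' j, ‖S (b j)‖ ^ 2) * ‖x‖ := by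
        gcongr
        · exact hS.sum_le_tsum s fun _ _ => sq_nonneg _
        · exact Real.sqrt_le_iff.2 ⟨norm_nonneg _, h1⟩

variable [DecidableEq ι]

/-- A product basis vector `⊗_{i ≠ k} e (f i)` of the factors other than `k`, as a family whose
`k`-th entry is irrelevant. -/
def basisFamily (k : ι) (f : ∀ i : {i // i ≠ k}, StdIndex (H i)) (i : ι) : H i :=
  if h : i = k then 0 else stdBasis (H i) (f ⟨i, h⟩)

/-- For a product basis vector `e_f = ⊗_{i ≠ k} e (f i)` of the factors other than `k`, the
isometric embedding `x ↦ x ⊗ e_f` of `H k` into `⨂ i, H i`, the vector `x` being put in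
position `k`. -/
def insertAt (k : ι) (f : ∀ i : {i // i ≠ k}, StdIndex (H i)) : H k →L[ℂ] HilbertTensor H :=
  tprod.toContinuousLinearMap (basisFamily k f) k

/-- The marginal of `ρ` on `H k`, i.e. the partial trace of `ρ` over all the factors other than
`k`: `⟪x, ρ_k y⟫ = ∑ f, ⟪x ⊗ e_f, ρ (y ⊗ e_f)⟫`, where `e_f` runs over an orthonormal product
basis of the tensor product of the other factors. -/
def marginal (ρ : HilbertTensor H →L[ℂ] HilbertTensor H) (k : ι) : H k →L[ℂ] H k :=
  ∑' f : ∀ i : {i // i ≠ k}, StdIndex (H i),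
    (insertAt k f).adjoint ∘L ρ ∘L insertAt k f

theorem insertAt_stdBasis (k : ι) (f : ∀ i : {i // i ≠ k}, StdIndex (H i)) (j : StdIndex (H k)) :
    insertAt k f (stdBasis (H k) j) = tensorBasis (fun i => stdBasis (H i))
      ((Equiv.piSplitAt k fun i => StdIndex (H i)).symm (j, f)) := by
  simp only [tensorBasis, HilbertBasis.coe_mkOfOrthogonalEqBot, insertAt,
    ContinuousMultilinearMap.toContinuousLinearMap_apply]
  congr 1
  funext i
  by_cases h : i = k
  · subst h
    simp [Equiv.piSplitAt]
  · simp [Equiv.piSplitAt, h, basisFamily]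

/-- For a state the series that defines a marginal converges in operator norm. -/
theorem summable_marginal {ρ : HilbertTensor H →L[ℂ] HilbertTensor H} (hρ : IsState ρ) (k : ι) :
    Summable fun f : ∀ i : {i // i ≠ k}, StdIndex (H i) =>
      (insertAt k f).adjoint ∘L ρ ∘L insertAt k f := by
  obtain ⟨S, hS⟩ := CStarAlgebra.nonneg_iff_eq_star_mul_self.1
    ((ContinuousLinearMap.nonneg_iff_isPositive ρ).2 hρ.1)
  have hin : ∀ v, ⟪v, ρ v⟫_ℂ = ((‖S v‖ ^ 2 : ℝ) : ℂ) := by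
    intro v
    rw [hS, mul_apply_eq_comp, ContinuousLinearMap.star_eq_adjoint,
      ContinuousLinearMap.adjoint_inner_right, inner_self_eq_norm_sq_to_K]
    norm_cast
  have hsum : Summable fun p : StdIndex (H k) × (∀ i : {i // i ≠ k}, StdIndex (H i)) =>
      ‖S (insertAt k p.2 (stdBasis (H k) p.1))‖ ^ 2 := by
    have h1 := (hρ.2 _ (tensorBasis fun i => stdBasis (H i))).summable
    simp only [hin] at h1
    rw [Complex.summable_ofReal] at h1
    have h2 := (Equiv.summable_iff (Equiv.piSplitAt k fun i => StdIndex (H i)).symm).2 h1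
    refine h2.congr fun p => ?_
    rw [insertAt_stdBasis]
    rfl
  have hsum' := (Equiv.prodComm _ _).summable_iff.2 hsum
  have hsum'' : Summable fun q : (∀ i : {i // i ≠ k}, StdIndex (H i)) × StdIndex (H k) =>
      ‖(S ∘L insertAt k q.1) (stdBasis (H k) q.2)‖ ^ 2 := hsum'
  refine Summable.of_norm_bounded hsum''.prod fun f => ?_
  have hT : (insertAt k f).adjoint ∘L ρ ∘L insertAt k f =
      (S ∘L insertAt k f).adjoint ∘L (S ∘L insertAt k f) := by
    rw [hS, ContinuousLinearMap.adjoint_comp]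
    rfl
  rw [hT, ContinuousLinearMap.norm_adjoint_comp_self, ← sq]
  exact opNorm_sq_le _ _ (hsum''.prod_factor f)

end Marginals
end Tensor
end QState
end

/-! In an orthonormal eigenbasis of `ρ` with eigenvalues `l j`, the FA-property asks for energies `g
j ≥ 0` on the positive eigenvalues with finite mean `∑ l j * g j` and `limsup Z(β)^β ≤ 1`, where
`Z(β) = ∑ exp (-β * g j)`; the lower bound is automatic, since one term of `Z` already gives it.
Functions `Z` of this kind are stable under sums, finite products and domination.

The key is `hasFAProperty_of_ensemble`: the energies may be attached to any decomposition `ρ = ∑ |v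
a⟩⟨v a|` instead of the spectral one. The weights `w j a = |⟨v a, b j⟩|² / l j` have row sums `1`
and column sums at most `1`, the latter because `|v a⟩⟨v a| ≤ ρ` forces `⟨v a, ρ⁻¹ v a⟩ ≤ 1`. For
the averaged energies `G j = ∑ w j a * g a`, Bessel's inequality bounds the mean energy and Jensen's
inequality bounds the partition function.

Convexity follows by uniting the scaled eigenvectors of two states, so that partition functions add.
For a state with FA marginals, take `v f = √ρ e_f` with `e_f` a product of eigenvectors of the
marginals and energy `∑ g k (f k)`: the mean energy splits into those of the marginals, and the
partition function is a product. For a product state the product eigenbasis gives one direction, and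
restriction to a one-factor slice gives the other. -/

noncomputable section

namespace QState

/-! ## Functions `Z` with `limsup Z β ^ β ≤ 1` as `β → 0+` -/

section Gibbs

/-- `Z β ^ β` has upper limit at most `1` as `β → 0+`. -/
def SubexpRoot (Z : ℝ → ℝ≥0∞) : Prop :=
  ∀ c : ℝ≥0∞, 1 < c → ∀ᶠ β in 𝓝[>] (0 : ℝ), Z β ^ β ≤ c

theorem eventually_pos_nhdsGT : ∀ᶠ β in 𝓝[>] (0 : ℝ), 0 < β := self_mem_nhdsWithin

theorem SubexpRoot.mono {Z W : ℝ → ℝ≥0∞} (hZ : SubexpRoot Z) (h : ∀ β, 0 < β → W β ≤ Z β) :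
    SubexpRoot W := fun _ hc => by
  filter_upwards [hZ _ hc, eventually_pos_nhdsGT] with β h1 h2
  exact (ENNReal.rpow_le_rpow (h β h2) h2.le).trans h1

theorem SubexpRoot.of_tendsto {Z : ℝ → ℝ≥0∞}
    (h : Tendsto (fun β => Z β ^ β) (𝓝[>] 0) (𝓝 1)) : SubexpRoot Z :=
  fun _ hc => (h.eventually (gt_mem_nhds hc)).mono fun _ h => h.le

theorem SubexpRoot.const {C : ℝ≥0∞} (hC : C ≠ ∞) : SubexpRoot fun _ => C := by
  -- The maximum with `1` keeps the base away from `0`, where `x ^ β` is not continuous at `β = 0`.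
  have h1 : SubexpRoot fun _ => max C 1 := by
    refine .of_tendsto ?_
    have h0 : max C 1 ≠ ∞ := by simp [hC]
    lift max C 1 to NNReal using h0 with D hD
    have hD1 : D ≠ 0 := by
      rintro rfl
      have := le_max_right C 1
      rw [← hD] at this
      simp at this
    have : Tendsto (fun β : ℝ => D ^ β) (𝓝[>] 0) (𝓝 1) := by
      have := (NNReal.continuousAt_rpow (x := D) (y := 0) (Or.inl hD1)).tendsto.comp
        ((tendsto_const_nhds (x := D)).prodMk_nhds
          (tendsto_nhdsWithin_of_tendsto_nhds (s := Set.Ioi 0) (tendsto_id (x := 𝓝 (0 : ℝ)))))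
      simpa [Function.comp_def] using this
    have h2 := ENNReal.tendsto_coe.2 this
    refine h2.congr fun β => ?_
    rw [ENNReal.coe_rpow_of_ne_zero hD1]
  exact h1.mono fun _ _ => le_max_left _ _

theorem SubexpRoot.mul {Z W : ℝ → ℝ≥0∞} (hZ : SubexpRoot Z) (hW : SubexpRoot W) :
    SubexpRoot fun β => Z β * W β := fun c hc => by
  have hd : 1 < c ^ (1 / 2 : ℝ) := ENNReal.one_lt_rpow hc (by norm_num)
  filter_upwards [hZ _ hd, hW _ hd, eventually_pos_nhdsGT] with β h1 h2 h3
  rw [ENNReal.mul_rpow_of_nonneg _ _ h3.le]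
  refine (mul_le_mul' h1 h2).trans (le_of_eq ?_)
  rw [← ENNReal.rpow_add_of_nonneg _ _ (by norm_num) (by norm_num)]
  norm_num

theorem SubexpRoot.max {Z W : ℝ → ℝ≥0∞} (hZ : SubexpRoot Z) (hW : SubexpRoot W) :
    SubexpRoot fun β => max (Z β) (W β) := fun _ hc => by
  filter_upwards [hZ _ hc, hW _ hc] with β h1 h2
  rcases max_choice (Z β) (W β) with h | h <;> rwa [h]

theorem SubexpRoot.add {Z W : ℝ → ℝ≥0∞} (hZ : SubexpRoot Z) (hW : SubexpRoot W) :
    SubexpRoot fun β => Z β + W β := by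
  refine ((SubexpRoot.const (C := 2) (by simp)).mul (hZ.max hW)).mono fun β _ => ?_
  rw [two_mul]
  exact add_le_add (le_max_left _ _) (le_max_right _ _)

theorem SubexpRoot.prod {κ : Type*} (s : Finset κ) {Z : κ → ℝ → ℝ≥0∞}
    (hZ : ∀ k ∈ s, SubexpRoot (Z k)) : SubexpRoot fun β => ∏ k ∈ s, Z k β := by
  classical
  induction s using Finset.induction_on with
  | empty => simpa using SubexpRoot.const (C := 1) (by simp)
  | insert a s ha ih =>
    simp only [Finset.prod_insert ha]
    exact (hZ a (Finset.mem_insert_self a s)).mul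
      (ih fun k hk => hZ k (Finset.mem_insert_of_mem hk))

/-- For `0 < β < 1` the sum is at most `2 / β`, and `(2 / β) ^ β → 1`. The energies `g i = i` serve
as filler on the zero entries of an eigenvalue sequence, where the energy is free but the partition
function must still converge. -/
theorem SubexpRoot.geometric :
    SubexpRoot fun β => ∑' i : ℕ, ENNReal.ofReal (Real.exp (-β * (i : ℝ))) := by
  intro c hc
  have hlim : Tendsto (fun β : ℝ => ENNReal.ofReal (2 / β) ^ β) (𝓝[>] 0) (𝓝 1) := by
    have h1 : Tendsto (fun β : ℝ => Real.exp (β * Real.log 2 - Real.log β * β)) (𝓝[>] 0)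
        (𝓝 (Real.exp (0 * Real.log 2 - 0))) := by
      refine (Real.continuous_exp.tendsto _).comp (Tendsto.sub ?_ ?_)
      · exact (tendsto_nhdsWithin_of_tendsto_nhds tendsto_id).mul_const _
      · simpa using tendsto_log_mul_rpow_nhdsGT_zero one_pos
    have h2 := ENNReal.tendsto_ofReal h1
    simp only [zero_mul, sub_zero, Real.exp_zero, ENNReal.ofReal_one] at h2
    refine h2.congr' ?_
    filter_upwards [eventually_pos_nhdsGT] with β hβ
    rw [ENNReal.ofReal_rpow_of_pos (by positivity), Real.rpow_def_of_pos (by positivity),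
      Real.log_div (by norm_num) hβ.ne']
    congr 2
    ring
  filter_upwards [SubexpRoot.of_tendsto hlim c hc, eventually_pos_nhdsGT,
    nhdsWithin_le_nhds (gt_mem_nhds (one_pos (α := ℝ)))] with β h1 h2 h3
  refine (ENNReal.rpow_le_rpow ?_ h2.le).trans h1
  have hr : Real.exp (-β) ≤ 1 / (1 + β) := by
    rw [Real.exp_neg, ← one_div]
    exact one_div_le_one_div_of_le (by positivity) (by linarith [Real.add_one_le_exp β])
  have hr1 : Real.exp (-β) < 1 := by simpa using h2
  have h4 : ∀ i : ℕ, Real.exp (-β * (i : ℝ)) = Real.exp (-β) ^ i := fun i => by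
    rw [← Real.exp_nat_mul, mul_comm]
  simp only [h4]
  rw [← ENNReal.ofReal_tsum_of_nonneg (fun i => by positivity)
    (summable_geometric_of_lt_one (Real.exp_pos _).le hr1),
    tsum_geometric_of_lt_one (Real.exp_pos _).le hr1]
  refine ENNReal.ofReal_le_ofReal ?_
  have h5 : β / 2 ≤ 1 - Real.exp (-β) := by
    have : 1 / (1 + β) ≤ 1 - β / 2 := by
      rw [div_le_iff₀ (by positivity)]
      nlinarith
    linarith
  calc (1 - Real.exp (-β))⁻¹ ≤ (β / 2)⁻¹ := inv_anti₀ (by positivity) h5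
    _ = 2 / β := by rw [inv_div]

/-- The partition function `β ↦ ∑ exp (-β * g a)` of a family of energies, as a sum in
`[0, ∞]`. -/
def partitionFn {α : Type*} (g : α → ℝ) (β : ℝ) : ℝ≥0∞ :=
  ∑' a, ENNReal.ofReal (Real.exp (-β * g a))

/-- A single term bounds the root below by `exp (-β² * g a)`, which tends to `1`. An empty sum would
give the limit `0`. -/
theorem tendsto_partitionFn_rpow {α : Type*} [Nonempty α] {g : α → ℝ}
    (h : SubexpRoot (partitionFn g)) :
    Tendsto (fun β => partitionFn g β ^ β) (𝓝[>] 0) (𝓝 1) := by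
  obtain ⟨a⟩ := ‹Nonempty α›
  have hlow : Tendsto (fun β : ℝ => ENNReal.ofReal (Real.exp (-β * g a * β))) (𝓝[>] 0)
      (𝓝 1) := by
    have : Continuous fun β : ℝ => ENNReal.ofReal (Real.exp (-β * g a * β)) :=
      ENNReal.continuous_ofReal.comp (by fun_prop)
    have := this.tendsto 0
    simp only [mul_zero, Real.exp_zero, ENNReal.ofReal_one] at this
    exact this.mono_left nhdsWithin_le_nhds
  refine tendsto_order.2 ⟨fun c hc => ?_, fun c hc => ?_⟩
  · filter_upwards [hlow.eventually (lt_mem_nhds hc), eventually_pos_nhdsGT] with β h1 h2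
    refine h1.trans_le ?_
    rw [Real.exp_mul, ← ENNReal.ofReal_rpow_of_pos (Real.exp_pos _)]
    exact ENNReal.rpow_le_rpow (ENNReal.le_tsum (f := fun a =>
      ENNReal.ofReal (Real.exp (-β * g a))) a) h2.le
  · obtain ⟨d, hd1, hd2⟩ := exists_between hc
    exact (h d hd1).mono fun β h => h.trans_lt hd2

theorem partitionFn_comp_le {α α' : Type*} (g : α → ℝ) {φ : α' → α}
    (hφ : Function.Injective φ) (β : ℝ) : partitionFn (g ∘ φ) β ≤ partitionFn g β :=
  ENNReal.tsum_comp_le_tsum_of_injective hφ fun a => ENNReal.ofReal (Real.exp (-β * g a))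

/-- In `[0, ∞]`, a finite product of sums is the sum of the products. -/
theorem tsum_prod_eq_prod_tsum {n : ℕ} {κ : Fin n → Type*} (f : ∀ k, κ k → ℝ≥0∞) :
    ∑' x : ∀ k, κ k, ∏ k, f k (x k) = ∏ k, ∑' j, f k j := by
  induction n with
  | zero => simp [tsum_fintype]
  | succ n ih =>
    rw [← (Fin.consEquiv κ).tsum_eq, ENNReal.tsum_prod', Fin.prod_univ_succ, ← ih,
      ← ENNReal.tsum_mul_right]
    refine tsum_congr fun j => ?_
    rw [← ENNReal.tsum_mul_left]
    refine tsum_congr fun x => ?_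
    rw [Fin.prod_univ_succ]
    simp [Fin.consEquiv]

theorem partitionFn_sum {n : ℕ} {κ : Fin n → Type*} (g : ∀ k, κ k → ℝ) (β : ℝ) :
    partitionFn (fun x : ∀ k, κ k => ∑ k, g k (x k)) β = ∏ k, partitionFn (g k) β := by
  simp only [partitionFn]
  rw [← tsum_prod_eq_prod_tsum]
  refine tsum_congr fun x => ?_
  rw [Finset.mul_sum, Real.exp_sum, ENNReal.ofReal_prod_of_nonneg fun _ _ => (Real.exp_pos _).le]

end Gibbs

/-! ## Hilbert--Schmidt norms and diagonalisation of states -/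

section HilbertSchmidt

variable {E F : Type*} [NormedAddCommGroup E] [InnerProductSpace ℂ E]
  [NormedAddCommGroup F] [InnerProductSpace ℂ F]

theorem hasSum_norm_inner_sq {κ : Type*} (b : HilbertBasis κ ℂ E) (x : E) :
    HasSum (fun j => ‖⟪b j, x⟫_ℂ‖ ^ 2) (‖x‖ ^ 2) := by
  have h := b.hasSum_inner_mul_inner x x
  have h1 : ∀ j, ⟪x, b j⟫_ℂ * ⟪b j, x⟫_ℂ = ((‖⟪b j, x⟫_ℂ‖ ^ 2 : ℝ) : ℂ) := fun j => by
    rw [← inner_conj_symm x (b j), RCLike.conj_mul]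
    norm_cast
  have h2 : ⟪x, x⟫_ℂ = ((‖x‖ ^ 2 : ℝ) : ℂ) := by
    rw [inner_self_eq_norm_sq_to_K]
    norm_cast
  simp only [h1, h2] at h
  exact Complex.hasSum_ofReal.1 h

theorem tsum_ofReal_norm_inner_sq {κ : Type*} (b : HilbertBasis κ ℂ E) (x : E) :
    ∑' j, ENNReal.ofReal (‖⟪b j, x⟫_ℂ‖ ^ 2) = ENNReal.ofReal (‖x‖ ^ 2) := by
  have h := hasSum_norm_inner_sq b x
  rw [← h.tsum_eq, ENNReal.ofReal_tsum_of_nonneg (fun _ => sq_nonneg _) h.summable]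

variable [CompleteSpace E] [CompleteSpace F]

/-- By Parseval both sides are the sum of all `|⟨b' i, T (b j)⟩|²`; in `[0, ∞]` the order of
summation is free. -/
theorem tsum_norm_sq_eq_adjoint {κ κ' : Type*} (b : HilbertBasis κ ℂ E)
    (b' : HilbertBasis κ' ℂ F) (T : E →L[ℂ] F) :
    ∑' j, ENNReal.ofReal (‖T (b j)‖ ^ 2) = ∑' i, ENNReal.ofReal (‖T.adjoint (b' i)‖ ^ 2) := by
  simp only [← tsum_ofReal_norm_inner_sq b, ← tsum_ofReal_norm_inner_sq b']
  rw [ENNReal.tsum_comm]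
  refine tsum_congr fun i => tsum_congr fun j => ?_
  rw [ContinuousLinearMap.adjoint_inner_right, norm_inner_symm]

/-- The Hilbert--Schmidt norm does not depend on the basis. -/
theorem tsum_norm_sq_eq {κ κ' : Type*} (b : HilbertBasis κ ℂ E)
    (b' : HilbertBasis κ' ℂ E) (T : E →L[ℂ] F) :
    ∑' j, ENNReal.ofReal (‖T (b j)‖ ^ 2) = ∑' i, ENNReal.ofReal (‖T (b' i)‖ ^ 2) := by
  obtain ⟨w, c, -⟩ := exists_hilbertBasis ℂ F
  rw [tsum_norm_sq_eq_adjoint b c, tsum_norm_sq_eq_adjoint b' c]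

end HilbertSchmidt

section Eigenbasis

variable {H : Type*} [NormedAddCommGroup H] [InnerProductSpace ℂ H]

/-- The basis `b` diagonalises `ρ`, with nonnegative eigenvalues `l` that sum up to `1`. -/
structure IsEigenbasis {κ : Type*} (ρ : H →L[ℂ] H) (b : HilbertBasis κ ℂ H) (l : κ → ℝ) :
    Prop where
  apply_eq : ∀ j, ρ (b j) = (l j : ℂ) • b j
  nonneg : ∀ j, 0 ≤ l j
  hasSum : HasSum l 1

namespace IsEigenbasis

variable {κ : Type*} {ρ : H →L[ℂ] H} {b : HilbertBasis κ ℂ H} {l : κ → ℝ}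

theorem hasSum_inner (h : IsEigenbasis ρ b l) (x : H) :
    HasSum (fun j => ((l j * ‖⟪b j, x⟫_ℂ‖ ^ 2 : ℝ) : ℂ)) ⟪x, ρ x⟫_ℂ := by
  have h1 : HasSum (fun j => ⟪x, ρ (b.repr x j • b j)⟫_ℂ) ⟪x, ρ x⟫_ℂ :=
    (b.hasSum_repr x).mapL ((innerSL ℂ x) ∘L ρ)
  convert h1 using 1
  funext j
  rw [map_smul, h.apply_eq, inner_smul_right, inner_smul_right, b.repr_apply_apply,
    ← inner_conj_symm x (b j), mul_left_comm, RCLike.mul_conj]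
  simp

theorem hasSum_re_inner (h : IsEigenbasis ρ b l) (x : H) :
    HasSum (fun j => l j * ‖⟪b j, x⟫_ℂ‖ ^ 2) (⟪x, ρ x⟫_ℂ).re := by
  simpa only [Complex.ofReal_re] using Complex.hasSum_re (h.hasSum_inner x)

theorem inner_apply_self (h : IsEigenbasis ρ b l) (j : κ) : ⟪b j, ρ (b j)⟫_ℂ = l j := by
  rw [h.apply_eq, inner_smul_right, inner_self_eq_norm_sq_to_K, b.orthonormal.1 j]
  simp

end IsEigenbasis

end Eigenbasis

/-! ### Spectral theorem for states, through the Hilbert--Schmidt operator `√ρ` -/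

section Spectral

variable {H : Type u} [NormedAddCommGroup H] [InnerProductSpace ℂ H] [CompleteSpace H]

theorem exists_selfAdjoint_sqrt {ρ : H →L[ℂ] H} (hρ : ρ.IsPositive) :
    ∃ S : H →L[ℂ] H, S.adjoint = S ∧ S ∘L S = ρ ∧
      ∀ x, ⟪x, ρ x⟫_ℂ = ((‖S x‖ ^ 2 : ℝ) : ℂ) := by
  have h0 : 0 ≤ ρ := (ContinuousLinearMap.nonneg_iff_isPositive ρ).2 hρ
  have h1 : (CFC.sqrt ρ).adjoint = CFC.sqrt ρ :=
    (((ContinuousLinearMap.nonneg_iff_isPositive _).1 (CFC.sqrt_nonneg ρ)).isSelfAdjoint).adjoint_eq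
  have h2 : CFC.sqrt ρ ∘L CFC.sqrt ρ = ρ := CFC.sqrt_mul_sqrt_self ρ
  refine ⟨CFC.sqrt ρ, h1, h2, fun x => ?_⟩
  conv_lhs => rw [← h2]
  rw [ContinuousLinearMap.comp_apply, ← ContinuousLinearMap.adjoint_inner_left, h1,
    inner_self_eq_norm_sq_to_K]
  norm_cast

theorem hasSum_ofReal_iff_tsum {κ : Type*} {f : κ → ℝ} (hf : ∀ j, 0 ≤ f j) :
    HasSum (fun j => (f j : ℂ)) 1 ↔ ∑' j, ENNReal.ofReal (f j) = 1 := by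
  rw [← Complex.ofReal_one, Complex.hasSum_ofReal]
  constructor
  · intro h
    rw [← ENNReal.ofReal_tsum_of_nonneg hf h.summable, h.tsum_eq, ENNReal.ofReal_one]
  · intro h
    have hs : Summable f := by
      have := ENNReal.summable_toReal (h.symm ▸ ENNReal.one_ne_top)
      simpa [ENNReal.toReal_ofReal (hf _)] using this
    rw [← ENNReal.ofReal_tsum_of_nonneg hf hs, ENNReal.ofReal_eq_one] at h
    exact h ▸ hs.hasSum

/-- It is enough to compute the trace in one orthonormal basis. -/
theorem IsState.of_basis {ρ : H →L[ℂ] H} (hρ : ρ.IsPositive) {κ : Type*}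
    (b : HilbertBasis κ ℂ H) (h : HasSum (fun j => ⟪b j, ρ (b j)⟫_ℂ) 1) : IsState ρ := by
  refine ⟨hρ, fun κ' b' => ?_⟩
  -- The trace of `ρ` is the squared Hilbert--Schmidt norm of `S = √ρ`, which is basis-independent.
  obtain ⟨S, -, -, hS⟩ := exists_selfAdjoint_sqrt hρ
  simp only [hS] at h ⊢
  rw [hasSum_ofReal_iff_tsum fun _ => sq_nonneg _] at h ⊢
  rw [← h, tsum_norm_sq_eq]

theorem IsEigenbasis.isState {κ : Type*} {ρ : H →L[ℂ] H} {b : HilbertBasis κ ℂ H} {l : κ → ℝ}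
    (h : IsEigenbasis ρ b l) : IsState ρ := by
  refine .of_basis ?_ b ?_
  · rw [ContinuousLinearMap.isPositive_iff_complex]
    intro x
    have h1 : ⟪x, ρ x⟫_ℂ = ((⟪x, ρ x⟫_ℂ).re : ℂ) :=
      (h.hasSum_inner x).unique (Complex.hasSum_ofReal.2 (h.hasSum_re_inner x))
    have h2 : 0 ≤ (⟪x, ρ x⟫_ℂ).re :=
      (h.hasSum_re_inner x).nonneg fun j => mul_nonneg (h.nonneg j) (sq_nonneg _)
    have h3 : ⟪ρ x, x⟫_ℂ = ((⟪x, ρ x⟫_ℂ).re : ℂ) := by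
      rw [← inner_conj_symm, h1]
      simp
    rw [h3]
    simpa using h2
  · simp only [h.inner_apply_self]
    exact Complex.hasSum_ofReal.2 h.hasSum

/-- `√ρ` is Hilbert--Schmidt, hence an operator-norm limit of its finite-rank truncations `P s`: the
error is at most the tail of the Hilbert--Schmidt sum. So `√ρ` is compact, and with it `ρ = √ρ ∘
√ρ`. -/
theorem IsState.isCompactOperator {ρ : H →L[ℂ] H} (hρ : IsState ρ) : IsCompactOperator ρ := by
  obtain ⟨w, b, -⟩ := exists_hilbertBasis ℂ H
  obtain ⟨S, -, hSS, hS⟩ := exists_selfAdjoint_sqrt hρ.1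
  have hsum : Summable fun j => ‖S (b j)‖ ^ 2 := by
    have := (hρ.2 _ b).summable
    simp only [hS] at this
    exact Complex.summable_ofReal.1 this
  classical
  let P : Finset w → H →L[ℂ] H := fun s =>
    ∑ j ∈ s, (innerSL ℂ (b j)).smulRight (S (b j))
  have hP : ∀ s, IsCompactOperator (P s) := by
    intro s
    induction s using Finset.induction_on with
    | empty => simpa [P] using isCompactOperator_zero
    | insert a s ha ih =>
      have h1 : IsCompactOperator ((innerSL ℂ (b a)).smulRight (S (b a))) :=
        (isCompactOperator_of_locallyCompactSpace_rng
          (ContinuousLinearMap.toSpanSingleton ℂ (S (b a)))).comp_clm (innerSL ℂ (b a))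
      simp only [P, Finset.sum_insert ha]
      exact h1.add ih
  have hPb : ∀ s j, P s (b j) = if j ∈ s then S (b j) else 0 := by
    intro s j
    simp [P, orthonormal_iff_ite.1 b.orthonormal]
  have hlim : Tendsto P atTop (𝓝 S) := by
    rw [tendsto_iff_norm_sub_tendsto_zero]
    have h1 : ∀ s, ‖P s - S‖ ≤ √(∑' j, ‖S (b j)‖ ^ 2 - ∑ j ∈ s, ‖S (b j)‖ ^ 2) := by
      intro s
      have h2 : HasSum (fun j => ‖(P s - S) (b j)‖ ^ 2)
          (∑' j, ‖S (b j)‖ ^ 2 - ∑ j ∈ s, ‖S (b j)‖ ^ 2) := by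
        have h3 := hsum.hasSum.sub (hasSum_sum_of_ne_finset_zero (s := s)
          (f := fun j => if j ∈ s then ‖S (b j)‖ ^ 2 else 0) fun j hj => if_neg hj)
        rw [Finset.sum_congr rfl fun j hj => if_pos hj] at h3
        refine h3.congr_fun fun j => ?_
        rw [sub_apply, hPb]
        split_ifs <;> simp
      refine Real.le_sqrt_of_sq_le ?_
      rw [← h2.tsum_eq]
      exact opNorm_sq_le b _ h2.summable
    refine squeeze_zero (fun _ => norm_nonneg _) h1 ?_
    have h4 : Tendsto (fun s : Finset w => √(∑' j, ‖S (b j)‖ ^ 2 - ∑ j ∈ s, ‖S (b j)‖ ^ 2))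
        atTop (𝓝 (√(∑' j, ‖S (b j)‖ ^ 2 - ∑' j, ‖S (b j)‖ ^ 2))) :=
      (Real.continuous_sqrt.tendsto _).comp (tendsto_const_nhds.sub hsum.hasSum)
    simpa using h4
  have hSc : IsCompactOperator S :=
    isCompactOperator_of_tendsto hlim (Eventually.of_forall hP)
  rw [← hSS]
  exact hSc.comp_clm S

/-- Orthonormal bases of all eigenspaces, the kernel included, are glued together; compactness and
symmetry make their joint span dense. -/
theorem IsState.exists_eigenbasis {ρ : H →L[ℂ] H} (hρ : IsState ρ) :
    ∃ (κ : Type u) (b : HilbertBasis κ ℂ H) (l : κ → ℝ), IsEigenbasis ρ b l := by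
  have hsym : (ρ : H →ₗ[ℂ] H).IsSymmetric := hρ.1.isSymmetric
  have hcl : ∀ μ : ℂ, CompleteSpace (Module.End.eigenspace (ρ : H →ₗ[ℂ] H) μ) := fun μ =>
    IsClosed.completeSpace_coe (hs := ContinuousLinearMap.isClosed_eigenspace ρ μ)
  have hex : ∀ μ : ℂ, ∃ (w : Set (Module.End.eigenspace (ρ : H →ₗ[ℂ] H) μ))
      (b : HilbertBasis w ℂ (Module.End.eigenspace (ρ : H →ₗ[ℂ] H) μ)), ⇑b = ((↑) : w → _) :=
    fun μ => exists_hilbertBasis ℂ _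
  choose w c hc using hex
  have hon := hsym.orthogonalFamily_eigenspaces.orthonormal_sigma_orthonormal
    (v_family := fun μ => c μ) fun μ => (c μ).orthonormal
  have hbot : (Submodule.span ℂ (Set.range fun a : Σ μ, w μ =>
      (Module.End.eigenspace (ρ : H →ₗ[ℂ] H) a.1).subtypeₗᵢ (c a.1 a.2)))ᗮ = ⊥ := by
    rw [eq_bot_iff, ← ContinuousLinearMap.orthogonalComplement_iSup_eigenspaces_eq_bot
      hρ.isCompactOperator hsym, ← Submodule.iInf_orthogonal]
    refine fun v hv => (Submodule.mem_iInf _).2 fun μ => ?_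
    have h0 : (innerSL ℂ v) ∘L (Module.End.eigenspace (ρ : H →ₗ[ℂ] H) μ).subtypeL = 0 := by
      refine ContinuousLinearMap.ext_on
        (Submodule.dense_iff_topologicalClosure_eq_top.2 (c μ).dense_span) ?_
      rintro _ ⟨j, rfl⟩
      exact (Submodule.mem_orthogonal' _ _).1 hv _ (Submodule.subset_span ⟨⟨μ, j⟩, rfl⟩)
    refine (Submodule.mem_orthogonal' _ _).2 fun x hx => ?_
    exact congrArg (fun T => T ⟨x, hx⟩) h0
  let b : HilbertBasis (Σ μ, w μ) ℂ H := HilbertBasis.mkOfOrthogonalEqBot hon hbot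
  have hb : ∀ a, ρ (b a) = a.1 • b a := by
    intro a
    simp only [b, HilbertBasis.coe_mkOfOrthogonalEqBot]
    exact Module.End.mem_eigenspace_iff.1 (c a.1 a.2).2
  have hb' : ∀ a, ⟪b a, ρ (b a)⟫_ℂ = a.1 := by
    intro a
    rw [hb, inner_smul_right, inner_self_eq_norm_sq_to_K, b.orthonormal.1 a]
    simp
  obtain ⟨S, -, -, hS⟩ := exists_selfAdjoint_sqrt hρ.1
  -- Writing the complex eigenvalue as `‖√ρ (b a)‖²` shows at once that it is real and nonnegative.
  have hl : ∀ a, a.1 = ((‖S (b a)‖ ^ 2 : ℝ) : ℂ) := fun a => by rw [← hb', hS]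
  refine ⟨_, b, fun a => ‖S (b a)‖ ^ 2, ⟨fun a => ?_, fun a => sq_nonneg _, ?_⟩⟩
  · rw [← hl, hb]
  · have h1 := hρ.2 _ b
    simp only [hS] at h1
    exact Complex.hasSum_ofReal.1 h1

end Spectral

/-! ## Eigenvalue sequences -/

section Rearrangement

variable {κ : Type*} {l : κ → ℝ}

theorem finite_setOf_le_of_summable (hs : Summable l) {t : ℝ} (ht : 0 < t) :
    {j | t ≤ l j}.Finite := by
  have := hs.tendsto_cofinite_zero.eventually (gt_mem_nhds ht)
  simpa [Filter.eventually_cofinite] using this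

/-- The non-increasing rearrangement of a nonnegative summable family. -/
theorem exists_antitone_rearrangement (h0 : ∀ j, 0 ≤ l j) (hs : Summable l) :
    ∃ a : ℕ → ℝ, Antitone a ∧ (∀ i, 0 ≤ a i) ∧
      ∀ μ : ℝ, 0 < μ → {i | a i = μ}.encard = {j | l j = μ}.encard := by
  -- `N` counts the entries above a threshold, and `a` is its generalized inverse. Past the last
  -- positive entry the set of thresholds is empty, and `sSup ∅ = 0` supplies the trailing zeros.
  let N : ℝ → ℕ := fun t => {j | t ≤ l j}.ncard
  let a : ℕ → ℝ := fun i => sSup {t | 0 < t ∧ i < N t}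
  have hfin := fun t (ht : 0 < t) => finite_setOf_le_of_summable hs ht
  have hbdd : ∀ i, BddAbove {t | 0 < t ∧ i < N t} := by
    refine fun i => ⟨∑' j, l j, fun t ht => ?_⟩
    have hne : {j | t ≤ l j}.Nonempty := by
      by_contra hemp
      rw [Set.not_nonempty_iff_eq_empty] at hemp
      have := ht.2
      simp [N, hemp] at this
    obtain ⟨j, hj⟩ := hne
    exact le_trans hj (hs.le_tsum j fun k _ => h0 k)
  have ha0 : ∀ i, 0 ≤ a i := fun i => Real.sSup_nonneg fun t ht => ht.1.le
  have key : ∀ t, 0 < t → ∀ i, t ≤ a i ↔ i < N t := by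
    intro t ht i
    refine ⟨fun h => ?_, fun h => le_csSup (hbdd i) ⟨ht, h⟩⟩
    by_contra hi
    -- Left continuity of `N` at `t`: only finitely many entries lie in `[t / 2, t)`, so some `M <
    -- t` dominates them all, and no threshold above `M` counts more entries than `t` does.
    have hF : {j | t / 2 ≤ l j ∧ l j < t}.Finite :=
      (hfin (t / 2) (half_pos ht)).subset fun j hj => hj.1
    have h1 : ∀ᶠ M in 𝓝[<] t, ∀ j ∈ {j | t / 2 ≤ l j ∧ l j < t}, l j ≤ M :=
      hF.eventually_all.2 fun j hj =>
        ((eventually_gt_nhds hj.2).filter_mono nhdsWithin_le_nhds).mono fun _ h => le_of_lt h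
    have h2 : ∀ᶠ M in 𝓝[<] t, t / 2 < M :=
      mem_nhdsWithin_of_mem_nhds (lt_mem_nhds (half_lt_self ht))
    obtain ⟨M, ⟨hM1, hM2⟩, hM3⟩ := ((h1.and h2).and (self_mem_nhdsWithin (s := Set.Iio t))).exists
    have hle : a i ≤ M := by
      refine Real.sSup_le (fun s hs => ?_) (by linarith)
      by_contra! hMs
      refine hi (hs.2.trans_le (Set.ncard_le_ncard (fun j (hj : s ≤ l j) => ?_) (hfin t ht)))
      by_contra hjt
      exact absurd (hM1 j ⟨by linarith, not_le.1 hjt⟩) (by linarith)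
    exact absurd (h.trans hle) (not_le.2 hM3)
  refine ⟨a, fun i i' hii => ?_, ha0, fun μ hμ => ?_⟩
  · rcases (ha0 i').eq_or_lt with h | h
    · exact h ▸ ha0 i
    · exact (key _ h i).2 (hii.trans_lt ((key _ h i').1 le_rfl))
  have hsub : {j | μ < l j} ⊆ {j | μ ≤ l j} := fun j (hj : μ < l j) => hj.le
  have key' : ∀ i, μ < a i ↔ i < {j | μ < l j}.ncard := by
    intro i
    constructor
    · intro h
      exact ((key _ (hμ.trans h) i).1 le_rfl).trans_le (Set.ncard_le_ncard
        (fun j hj => h.trans_le hj) ((hfin μ hμ).subset hsub))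
    · intro h
      have h1 : ∀ᶠ M in 𝓝[>] μ, ∀ j ∈ {j | μ < l j}, M ≤ l j :=
        ((hfin μ hμ).subset hsub).eventually_all.2 fun j hj =>
          ((eventually_lt_nhds hj).filter_mono nhdsWithin_le_nhds).mono fun _ h => le_of_lt h
      obtain ⟨M, hM1, hM2⟩ := (h1.and (self_mem_nhdsWithin (s := Set.Ioi μ))).exists
      have hM2' : μ < M := hM2
      refine hM2'.trans_le ((key M (hμ.trans hM2') i).2 (h.trans_le ?_))
      exact Set.ncard_le_ncard hM1 (hfin M (hμ.trans hM2'))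
  -- The level set of `a` is an interval whose length is the number of entries `≥ μ` minus the
  -- number of entries `> μ`.
  have h1 : {i | a i = μ} = (Finset.Ico {j | μ < l j}.ncard (N μ) : Finset ℕ) := by
    ext i
    rw [Finset.coe_Ico]
    change a i = μ ↔ _ ≤ i ∧ i < N μ
    rw [← key μ hμ, ← not_lt, ← key']
    exact ⟨fun h => ⟨by simp [h], h.ge⟩, fun h => le_antisymm (not_lt.1 h.1) h.2⟩
  have h2 : {j | l j = μ} = {j | μ ≤ l j} \ {j | μ < l j} := by
    ext j
    simp only [Set.mem_ofPred_eq, Set.mem_sdiff, not_lt]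
    exact ⟨fun h => ⟨h.ge, h.le⟩, fun h => le_antisymm h.2 h.1⟩
  rw [h1, Set.encard_coe_eq_coe_finsetCard, Nat.card_Ico, h2,
    ← ((hfin μ hμ).subset Set.sdiff_subset).cast_ncard_eq,
    Set.ncard_sdiff hsub ((hfin μ hμ).subset hsub)]

end Rearrangement

section EigenvalueSequence

variable {H : Type u} [NormedAddCommGroup H] [InnerProductSpace ℂ H] [CompleteSpace H]
  {κ : Type u} {ρ : H →L[ℂ] H} {b : HilbertBasis κ ℂ H} {l : κ → ℝ}

/-- By symmetry of `ρ`, an eigenvector for `μ` has no component along `b j` unless `l j = μ`.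
Summability leaves finitely many such `j`, so its expansion is a finite sum and the algebraic span
is the whole eigenspace. -/
theorem IsEigenbasis.encard_eq (h : IsEigenbasis ρ b l) {μ : ℝ} (hμ : 0 < μ) :
    {j | l j = μ}.encard =
      Cardinal.toENat (Module.rank ℂ (Module.End.eigenspace (ρ : H →ₗ[ℂ] H) (μ : ℂ))) := by
  have hfin : {j | l j = μ}.Finite :=
    (finite_setOf_le_of_summable h.hasSum.summable hμ).subset fun j hj => le_of_eq hj.symm
  have hli : LinearIndependent ℂ fun j : {j | l j = μ} => b j :=
    (b.orthonormal.comp _ Subtype.val_injective).linearIndependent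
  have hspan : Module.End.eigenspace (ρ : H →ₗ[ℂ] H) (μ : ℂ) =
      Submodule.span ℂ (Set.range fun j : {j | l j = μ} => b j) := by
    refine le_antisymm (fun x hx => ?_) (Submodule.span_le.2 ?_)
    · have hx' : ρ x = (μ : ℂ) • x := Module.End.mem_eigenspace_iff.1 hx
      have hz : ∀ j, j ∉ hfin.toFinset → b.repr x j • b j = 0 := by
        intro j hj
        have h1 : (l j : ℂ) * ⟪b j, x⟫_ℂ = μ * ⟪b j, x⟫_ℂ := by
          have := h.isState.1.isSymmetric (b j) x
          rw [ContinuousLinearMap.coe_coe, h.apply_eq, hx', inner_smul_left, inner_smul_right]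
            at this
          simpa using this
        have h2 : (l j : ℂ) ≠ μ := by
          rw [Ne, Complex.ofReal_inj]
          simpa using hj
        rw [b.repr_apply_apply, (mul_eq_mul_right_iff.1 h1).resolve_left h2, zero_smul]
      rw [(b.hasSum_repr x).unique (hasSum_sum_of_ne_finset_zero hz)]
      exact Submodule.sum_mem _ fun j hj => Submodule.smul_mem _ _
        (Submodule.subset_span ⟨⟨j, by simpa using hj⟩, rfl⟩)
    · rintro _ ⟨⟨j, hj⟩, rfl⟩
      refine Module.End.mem_eigenspace_iff.2 ?_
      have hj' : l j = μ := hj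
      simpa [hj'] using h.apply_eq j
  rw [hspan, rank_span hli, Cardinal.mk_range_eq _ hli.injective]
  rfl

theorem IsEigenbasis.exists_isEigenvalueSequence (h : IsEigenbasis ρ b l) :
    ∃ a : ℕ → ℝ, IsEigenvalueSequence ρ a := by
  obtain ⟨a, h1, h2, h3⟩ := exists_antitone_rearrangement h.nonneg h.hasSum.summable
  exact ⟨a, h1, h2, fun μ hμ => (h3 μ hμ).trans (h.encard_eq hμ)⟩

/-- Over each `μ > 0` the two fibres are finite with equally many elements; bijections of the fibres
are glued. Zero eigenvalues are left out because their number need not match. -/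
theorem IsEigenbasis.exists_equiv (h : IsEigenbasis ρ b l) {a : ℕ → ℝ}
    (ha : IsEigenvalueSequence ρ a) :
    ∃ e : {i // 0 < a i} ≃ {j // 0 < l j}, ∀ i, l (e i) = a i := by
  have hfib : ∀ μ : ℝ, Nonempty ({i : {i // 0 < a i} // a i = μ} ≃ {j : {j // 0 < l j} // l j = μ}) := by
    intro μ
    by_cases hμ : 0 < μ
    · have henc := (ha.2.2 μ hμ).trans (h.encard_eq hμ).symm
      have hfin : {j | l j = μ}.Finite :=
        (finite_setOf_le_of_summable h.hasSum.summable hμ).subset fun j hj => le_of_eq hj.symm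
      have hfin' : {i | a i = μ}.Finite := by
        rw [← Set.encard_lt_top_iff, henc]
        exact hfin.encard_lt_top
      have hcard : Nat.card {i | a i = μ} = Nat.card {j | l j = μ} := by
        rw [Nat.card_coe_set_eq, Nat.card_coe_set_eq, Set.ncard_def, Set.ncard_def, henc]
      have := hfin.to_subtype
      have := hfin'.to_subtype
      have e1 : {i : {i // 0 < a i} // a i = μ} ≃ {i // a i = μ} :=
        Equiv.subtypeSubtypeEquivSubtype fun {i} (hi : a i = μ) => hi ▸ hμ
      have e2 : {j : {j // 0 < l j} // l j = μ} ≃ {j // l j = μ} :=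
        Equiv.subtypeSubtypeEquivSubtype fun {j} (hj : l j = μ) => hj ▸ hμ
      exact ⟨e1.trans ((Finite.card_eq.1 hcard).some.trans e2.symm)⟩
    · have : IsEmpty {i : {i // 0 < a i} // a i = μ} := ⟨fun i => hμ (i.2 ▸ i.1.2)⟩
      have : IsEmpty {j : {j // 0 < l j} // l j = μ} := ⟨fun i => hμ (i.2 ▸ i.1.2)⟩
      exact ⟨Equiv.equivOfIsEmpty _ _⟩
  exact ⟨Equiv.ofFiberEquiv fun μ => (hfib μ).some, fun i =>
    Equiv.ofFiberEquiv_map (g := fun j : {j // 0 < l j} => l j) (fun μ => (hfib μ).some) i⟩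

/-- The FA-property in terms of an arbitrary orthonormal basis of eigenvectors. -/
theorem IsEigenbasis.hasFAProperty_iff (h : IsEigenbasis ρ b l) :
    HasFAProperty ρ ↔ ∃ g : {j // 0 < l j} → ℝ, (∀ j, 0 ≤ g j) ∧
      Summable (fun j : {j // 0 < l j} => l j * g j) ∧ SubexpRoot (partitionFn g) := by
  constructor
  · rintro ⟨a, ha, g, hg0, hgs, hg⟩
    obtain ⟨e, he⟩ := h.exists_equiv ha
    refine ⟨fun j => g (e.symm j), fun j => hg0 _, ?_, ?_⟩
    · refine e.summable_iff.1 ?_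
      refine (hgs.subtype {i | 0 < a i}).congr fun i => ?_
      simp [he]
    · exact (SubexpRoot.of_tendsto hg).mono fun β _ =>
        partitionFn_comp_le g (Subtype.val_injective.comp e.symm.injective) β
  · rintro ⟨g, hg0, hgs, hg⟩
    obtain ⟨a, ha⟩ := h.exists_isEigenvalueSequence
    obtain ⟨e, he⟩ := h.exists_equiv ha
    -- On the zero entries the energy `i` costs nothing in the mean and adds at most a geometric
    -- series to the partition function.
    let g' : ℕ → ℝ := fun i => if hi : 0 < a i then g (e ⟨i, hi⟩) else i
    have hg' : ∀ i : {i // 0 < a i}, g' i = g (e i) := fun i => dif_pos i.2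
    refine ⟨a, ha, g', fun i => ?_, ?_, ?_⟩
    · by_cases hi : 0 < a i
      · simpa [g', hi] using hg0 _
      · simp [g', hi]
    · have h1 : Summable fun i : {i // 0 < a i} => a i * g' i :=
        (e.summable_iff.2 hgs).congr fun i => by simp [hg', he]
      refine (summable_subtype_iff_indicator (s := {i | 0 < a i})
        (f := fun i => a i * g' i)).1 h1 |>.congr fun i => ?_
      by_cases hi : 0 < a i
      · simp [hi]
      · simp [le_antisymm (not_lt.1 hi) (ha.2.1 i)]
    · refine tendsto_partitionFn_rpow ((hg.add SubexpRoot.geometric).mono fun β _ => ?_)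
      rw [partitionFn, ← Summable.tsum_add_tsum_compl (s := {i | 0 < a i}) ENNReal.summable
        ENNReal.summable]
      refine add_le_add ?_ ?_
      · rw [partitionFn, ← e.tsum_eq]
        exact le_of_eq (tsum_congr fun i => by rw [hg' i])
      · refine le_trans (le_of_eq (tsum_congr fun i => ?_))
          (ENNReal.tsum_comp_le_tsum_of_injective
          (f := ((↑) : ({i | 0 < a i}ᶜ : Set ℕ) → ℕ)) Subtype.val_injective
          fun i : ℕ => ENNReal.ofReal (Real.exp (-β * (i : ℝ))))
        have hi : ¬ 0 < a i := i.2
        simp [g', hi]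

/-- A variant of `IsEigenbasis.hasFAProperty_iff` with energies that are defined for all basis
vectors. -/
theorem IsEigenbasis.hasFAProperty_iff' (h : IsEigenbasis ρ b l) :
    HasFAProperty ρ ↔ ∃ g : κ → ℝ, (∀ j, 0 ≤ g j) ∧ Summable (fun j => l j * g j) ∧
      SubexpRoot (partitionFn fun j : {j // 0 < l j} => g j) := by
  rw [h.hasFAProperty_iff]
  constructor
  · rintro ⟨g, hg0, hgs, hg⟩
    have hext : ∀ j : {j // 0 < l j},
        Function.extend ((↑) : {j // 0 < l j} → κ) g 0 j = g j :=
      fun j => Subtype.val_injective.extend_apply g 0 j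
    refine ⟨Function.extend (↑) g 0, fun j => ?_, ?_, by simpa only [hext] using hg⟩
    · by_cases hj : 0 < l j
      · exact (hext ⟨j, hj⟩).symm ▸ hg0 _
      · rw [Function.extend_apply' _ _ _ (by simpa using hj)]
        rfl
    · refine (Subtype.val_injective.summable_iff fun j hj => ?_).1
        (hgs.congr fun j => by rw [Function.comp_apply, hext])
      have hj' : ¬ 0 < l j := by simpa using hj
      rw [le_antisymm (not_lt.1 hj') (h.nonneg j), zero_mul]
  · rintro ⟨g, hg0, hgs, hg⟩
    exact ⟨fun j => g j, fun j => hg0 j, hgs.comp_injective Subtype.val_injective, hg⟩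

end EigenvalueSequence

/-! ## The FA-property from a decomposition into rank one operators, and convexity -/

section Ensemble

variable {H : Type u} [NormedAddCommGroup H] [InnerProductSpace ℂ H]

theorem IsEigenbasis.sum_div_le_one {κ : Type*} {ρ : H →L[ℂ] H} {b : HilbertBasis κ ℂ H}
    {l : κ → ℝ} (h : IsEigenbasis ρ b l) {v : H}
    (hv : ∀ x, ‖⟪v, x⟫_ℂ‖ ^ 2 ≤ (⟪x, ρ x⟫_ℂ).re) (F : Finset κ) (hF : ∀ j ∈ F, 0 < l j) :
    ∑ j ∈ F, ‖⟪v, b j⟫_ℂ‖ ^ 2 / l j ≤ 1 := by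
  set s := ∑ j ∈ F, ‖⟪v, b j⟫_ℂ‖ ^ 2 / l j with hs
  have hs0 : 0 ≤ s := Finset.sum_nonneg fun j hj => div_nonneg (sq_nonneg _) (hF j hj).le
  -- This is `ρ⁻¹ v` cut down to `F`. Both `⟨v, x⟩` and `⟨x, ρ x⟩` equal `s`, so `hv x` reads `s² ≤
  -- s`.
  let x : H := ∑ j ∈ F, (⟪b j, v⟫_ℂ / l j) • b j
  have hn : ∀ j, ⟪b j, v⟫_ℂ * ⟪v, b j⟫_ℂ = ((‖⟪v, b j⟫_ℂ‖ ^ 2 : ℝ) : ℂ) := fun j => by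
    rw [← inner_conj_symm (b j) v, RCLike.conj_mul]
    norm_cast
  have h1 : ⟪v, x⟫_ℂ = (s : ℂ) := by
    simp only [x, inner_sum, inner_smul_right, hs, Complex.ofReal_sum, Complex.ofReal_div]
    refine Finset.sum_congr rfl fun j _ => ?_
    rw [div_mul_eq_mul_div, hn]
  have h2 : ⟪x, ρ x⟫_ℂ = (s : ℂ) := by
    have h3 : ρ x = ∑ j ∈ F, ⟪b j, v⟫_ℂ • b j := by
      simp only [x, map_sum, map_smul, h.apply_eq, smul_smul]
      refine Finset.sum_congr rfl fun j hj => ?_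
      rw [div_mul_cancel₀]
      exact_mod_cast (hF j hj).ne'
    rw [h3, b.orthonormal.inner_sum, hs, Complex.ofReal_sum]
    refine Finset.sum_congr rfl fun j _ => ?_
    rw [map_div₀, inner_conj_symm, Complex.conj_ofReal, div_mul_eq_mul_div, mul_comm, hn,
      Complex.ofReal_div]
  have h4 := hv x
  rw [h1, h2, Complex.norm_real, Complex.ofReal_re, Real.norm_of_nonneg hs0] at h4
  by_contra! h5
  nlinarith

/-- Jensen's inequality for `exp (-β ·)` and a countable convex combination. -/
theorem exp_neg_tsum_le {α : Type*} {w g : α → ℝ} (hw : ∀ a, 0 ≤ w a) (hw1 : HasSum w 1)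
    (hg : ∀ a, 0 ≤ g a) (hwg : Summable fun a => w a * g a) {β : ℝ} (hβ : 0 ≤ β) :
    ENNReal.ofReal (Real.exp (-β * ∑' a, w a * g a)) ≤
      ∑' a, ENNReal.ofReal (w a) * ENNReal.ofReal (Real.exp (-β * g a)) := by
  set G := ∑' a, w a * g a
  have hsum : Summable fun a => w a * Real.exp (-β * g a) := by
    refine .of_nonneg_of_le (fun a => mul_nonneg (hw a) (Real.exp_pos _).le) (fun a => ?_)
      hw1.summable
    refine mul_le_of_le_one_right (hw a) (Real.exp_le_one_iff.2 ?_)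
    nlinarith [mul_nonneg hβ (hg a)]
  simp only [← ENNReal.ofReal_mul (hw _)]
  rw [← ENNReal.ofReal_tsum_of_nonneg (fun a => mul_nonneg (hw a) (Real.exp_pos _).le) hsum]
  refine ENNReal.ofReal_le_ofReal ?_
  -- The average of the tangent line to `exp (-β ·)` at the mean `G`; the curve lies above it term
  -- by term.
  have h1 : HasSum (fun a => Real.exp (-β * G) * (w a * (1 + β * G) - β * (w a * g a)))
      (Real.exp (-β * G) * (1 * (1 + β * G) - β * G)) :=
    ((hw1.mul_right _).sub (hwg.hasSum.mul_left β)).mul_left _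
  have h2 : Real.exp (-β * G) * (1 * (1 + β * G) - β * G) = Real.exp (-β * G) := by ring
  rw [h2] at h1
  refine hasSum_le (fun a => ?_) h1 hsum.hasSum
  have h3 := Real.add_one_le_exp (-β * g a - -β * G)
  have h4 : Real.exp (-β * g a) = Real.exp (-β * G) * Real.exp (-β * g a - -β * G) := by
    rw [← Real.exp_add]
    congr 1
    ring
  rw [h4, mul_left_comm (w a) (Real.exp _)]
  refine mul_le_mul_of_nonneg_left ?_ (Real.exp_pos _).le
  calc w a * (1 + β * G) - β * (w a * g a) = w a * (-β * g a - -β * G + 1) := by ring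
    _ ≤ _ := mul_le_mul_of_nonneg_left h3 (hw a)

variable [CompleteSpace H]

/-- If `ρ = ∑ |v a⟩⟨v a|`, and there are energies `g a` with `∑ ‖v a‖ ^ 2 * g a < ∞` and a slowly
growing partition function, then `ρ` has the FA-property. -/
theorem hasFAProperty_of_ensemble {ρ : H →L[ℂ] H} (hρ : IsState ρ) {α : Type*} {v : α → H}
    {g : α → ℝ} (hg0 : ∀ a, 0 ≤ g a)
    (hv : ∀ x, HasSum (fun a => ‖⟪v a, x⟫_ℂ‖ ^ 2) (⟪x, ρ x⟫_ℂ).re)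
    (hs : Summable fun a => ‖v a‖ ^ 2 * g a) (hg : SubexpRoot (partitionFn g)) :
    HasFAProperty ρ := by
  obtain ⟨κ, b, l, h⟩ := hρ.exists_eigenbasis
  -- Rows of `w` are probability distributions, which Jensen needs; columns sum to at most `1` by
  -- `sum_div_le_one`, which then removes `w` from the bound on the partition function.
  let w : {j // 0 < l j} → α → ℝ := fun j a => ‖⟪v a, b j⟫_ℂ‖ ^ 2 / l j
  have hw0 : ∀ j a, 0 ≤ w j a := fun j a => div_nonneg (sq_nonneg _) j.2.le
  have hw1 : ∀ j, HasSum (w j) 1 := by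
    intro j
    have h1 := (hv (b j)).div_const (l j)
    rwa [h.inner_apply_self, Complex.ofReal_re, div_self j.2.ne'] at h1
  have hle : ∀ (j : κ) a, ‖⟪v a, b j⟫_ℂ‖ ^ 2 * g a ≤ ‖v a‖ ^ 2 * g a := fun j a => by
    refine mul_le_mul_of_nonneg_right (pow_le_pow_left₀ (norm_nonneg _) ?_ 2) (hg0 a)
    simpa [b.orthonormal.1 j] using norm_inner_le_norm (𝕜 := ℂ) (v a) (b j)
  have hsj : ∀ j : κ, Summable fun a => ‖⟪v a, b j⟫_ℂ‖ ^ 2 * g a := fun j =>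
    .of_nonneg_of_le (fun a => mul_nonneg (sq_nonneg _) (hg0 a)) (hle j) hs
  have hwg : ∀ j, Summable fun a => w j a * g a := fun j => by
    refine ((hsj j).div_const (l j)).congr fun a => ?_
    simp only [w]
    ring
  refine h.hasFAProperty_iff.2 ⟨fun j => ∑' a, w j a * g a,
    fun j => tsum_nonneg fun a => mul_nonneg (hw0 j a) (hg0 a), ?_, ?_⟩
  · have heq : ∀ j : {j // 0 < l j},
        l j * ∑' a, w j a * g a = ∑' a, ‖⟪v a, b j⟫_ℂ‖ ^ 2 * g a := fun j => by
      rw [← tsum_mul_left]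
      refine tsum_congr fun a => ?_
      simp only [w]
      field_simp [j.2.ne']
    simp only [heq]
    refine summable_of_sum_le (c := ∑' a, ‖v a‖ ^ 2 * g a)
      (fun j => tsum_nonneg fun a => mul_nonneg (sq_nonneg _) (hg0 a)) fun F => ?_
    rw [← Summable.tsum_finsetSum (f := fun (j : {j // 0 < l j}) a => ‖⟪v a, b j⟫_ℂ‖ ^ 2 * g a)
      fun j _ => hsj j]
    refine Summable.tsum_le_tsum (fun a => ?_) (summable_sum fun j _ => hsj j) hs
    rw [← Finset.sum_mul]
    refine mul_le_mul_of_nonneg_right ?_ (hg0 a)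
    -- Bessel's inequality for `v a`.
    have := (b.orthonormal.comp _ Subtype.val_injective).sum_inner_products_le (v a) (s := F)
    simpa [norm_inner_symm (v a)] using this
  · refine hg.mono fun β hβ => ?_
    calc partitionFn (fun j => ∑' a, w j a * g a) β
        ≤ ∑' j, ∑' a, ENNReal.ofReal (w j a) * ENNReal.ofReal (Real.exp (-β * g a)) :=
          ENNReal.tsum_le_tsum fun j => exp_neg_tsum_le (hw0 j) (hw1 j) hg0 (hwg j) hβ.le
      _ = ∑' a, (∑' j, ENNReal.ofReal (w j a)) * ENNReal.ofReal (Real.exp (-β * g a)) := by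
          rw [ENNReal.tsum_comm]
          simp only [ENNReal.tsum_mul_right]
      _ ≤ ∑' a, 1 * ENNReal.ofReal (Real.exp (-β * g a)) := by
          refine ENNReal.tsum_le_tsum fun a => mul_le_mul_left ?_ _
          rw [ENNReal.tsum_eq_iSup_sum]
          refine iSup_le fun F => ?_
          rw [← ENNReal.ofReal_sum_of_nonneg fun j _ => hw0 j a, ENNReal.ofReal_le_one]
          have := h.sum_div_le_one (v := v a)
            (fun x => le_hasSum (hv x) a fun _ _ => sq_nonneg _)
            (F.map (Function.Embedding.subtype _)) (by simp +contextual)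
          simpa [w] using this
      _ = partitionFn g β := by simp [partitionFn]

end Ensemble

/-! ### Convexity of the set of FA states -/

section Convexity

variable {H : Type u} [NormedAddCommGroup H] [InnerProductSpace ℂ H]

theorem IsState.convexComb {ρ σ : H →L[ℂ] H} (hρ : IsState ρ) (hσ : IsState σ) {p q : ℝ}
    (hp : 0 ≤ p) (hq : 0 ≤ q) (hpq : p + q = 1) : IsState (p • ρ + q • σ) := by
  constructor
  · rw [RCLike.real_smul_eq_coe_smul (K := ℂ), RCLike.real_smul_eq_coe_smul (K := ℂ)]
    exact (hρ.1.smul_of_nonneg (by simpa using hp)).add (hσ.1.smul_of_nonneg (by simpa using hq))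
  · intro κ b
    have h := ((hρ.2 κ b).mul_left (p : ℂ)).add ((hσ.2 κ b).mul_left (q : ℂ))
    have h1 : (p : ℂ) * 1 + q * 1 = 1 := by
      rw [mul_one, mul_one]
      exact_mod_cast hpq
    rw [h1] at h
    refine h.congr_fun fun j => ?_
    simp

/-- The rank one decomposition of `p • ρ` that enters the ensemble of a mixture. Only positive
eigenvalues are kept, as the partition function is controlled only there. -/
theorem IsEigenbasis.hasSum_sqrt_smul {κ : Type*} {ρ : H →L[ℂ] H} {b : HilbertBasis κ ℂ H}
    {l : κ → ℝ} (h : IsEigenbasis ρ b l) {p : ℝ} (hp : 0 ≤ p) (x : H) :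
    HasSum (fun j : {j // 0 < l j} => ‖⟪((√(p * l j) : ℝ) : ℂ) • b j, x⟫_ℂ‖ ^ 2)
      (p * (⟪x, ρ x⟫_ℂ).re) := by
  have h1 := (h.hasSum_re_inner x).mul_left p
  rw [← hasSum_subtype_iff_of_support_subset (s := {j | 0 < l j})] at h1
  · refine h1.congr_fun fun j => ?_
    rw [inner_smul_left, norm_mul, mul_pow, Complex.conj_ofReal, Complex.norm_real,
      Real.norm_of_nonneg (Real.sqrt_nonneg _), Real.sq_sqrt (mul_nonneg hp (h.nonneg _))]
    simp [mul_assoc]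
  · intro j hj
    refine lt_of_le_of_ne (h.nonneg j) fun h0 => hj ?_
    simp [← h0]

variable [CompleteSpace H]

theorem convex_FAStates : Convex ℝ (FAStates H) := by
  rintro ρ ⟨hρ, hρF⟩ σ ⟨hσ, hσF⟩ p q hp hq hpq
  have hτ := hρ.convexComb hσ hp hq hpq
  refine ⟨hτ, ?_⟩
  obtain ⟨κ, b, l, h⟩ := hρ.exists_eigenbasis
  obtain ⟨κ', b', l', h'⟩ := hσ.exists_eigenbasis
  obtain ⟨g, hg0, hgs, hg⟩ := h.hasFAProperty_iff.1 hρF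
  obtain ⟨g', hg0', hgs', hg'⟩ := h'.hasFAProperty_iff.1 hσF
  refine hasFAProperty_of_ensemble hτ (α := {j // 0 < l j} ⊕ {j // 0 < l' j})
    (v := Sum.elim (fun j => ((√(p * l j) : ℝ) : ℂ) • b j)
      fun j => ((√(q * l' j) : ℝ) : ℂ) • b' j) (g := Sum.elim g g') ?_ ?_ ?_ ?_
  · rintro (j | j)
    exacts [hg0 j, hg0' j]
  · intro x
    have h1 : (⟪x, (p • ρ + q • σ) x⟫_ℂ).re =
        p * (⟪x, ρ x⟫_ℂ).re + q * (⟪x, σ x⟫_ℂ).re := by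
      simp
    rw [h1]
    exact HasSum.sum (h.hasSum_sqrt_smul hp x) (h'.hasSum_sqrt_smul hq x)
  · have key : ∀ {κ : Type u} (b : HilbertBasis κ ℂ H) (j : κ) {t : ℝ}, 0 ≤ t →
        ‖((√t : ℝ) : ℂ) • b j‖ ^ 2 = t := fun b j t ht => by
      rw [norm_smul, b.orthonormal.1 j, Complex.norm_real,
        Real.norm_of_nonneg (Real.sqrt_nonneg _), mul_one, Real.sq_sqrt ht]
    refine Summable.sum _ ((hgs.mul_left p).congr fun j => ?_)
      ((hgs'.mul_left q).congr fun j => ?_)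
    · simp only [Function.comp_apply, Sum.elim_inl]
      rw [key b _ (mul_nonneg hp (h.nonneg _)), mul_assoc]
    · simp only [Function.comp_apply, Sum.elim_inr]
      rw [key b' _ (mul_nonneg hq (h'.nonneg _)), mul_assoc]
  · refine (hg.add hg').mono fun β _ => le_of_eq ?_
    simp only [partitionFn]
    rw [ENNReal.summable.tsum_sum ENNReal.summable]
    simp

end Convexity

/-! ## Tensor products -/

theorem summable_iff_tsum_ofReal_ne_top {κ : Type*} {f : κ → ℝ} (hf : ∀ j, 0 ≤ f j) :
    Summable f ↔ ∑' j, ENNReal.ofReal (f j) ≠ ∞ := by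
  constructor
  · intro h
    rw [← ENNReal.ofReal_tsum_of_nonneg hf h]
    exact ENNReal.ofReal_ne_top
  · intro h
    simpa [ENNReal.toReal_ofReal (hf _)] using ENNReal.summable_toReal h

/-! ### Product states -/

section ProductStates

variable {n : ℕ} {H : Fin n → Type u} [∀ k, NormedAddCommGroup (H k)]
  [∀ k, InnerProductSpace ℂ (H k)] [∀ k, CompleteSpace (H k)] {κ : Fin n → Type u}
  {b : ∀ k, HilbertBasis (κ k) ℂ (H k)} {l : ∀ k, κ k → ℝ} {ρ : ∀ k, H k →L[ℂ] H k}

theorem tensorBasis_apply (b : ∀ k, HilbertBasis (κ k) ℂ (H k)) (f : ∀ k, κ k) :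
    tensorBasis b f = tprod fun k => b k (f k) := by
  simp [tensorBasis]

theorem IsEigenbasis.tensorOp (h : ∀ k, IsEigenbasis (ρ k) (b k) (l k)) :
    IsEigenbasis (tensorOp ρ) (tensorBasis b) fun f => ∏ k, l k (f k) where
  apply_eq f := by
    rw [tensorBasis_apply, tensorOp_tprod]
    simp only [(h _).apply_eq]
    rw [ContinuousMultilinearMap.map_smul_univ, Complex.ofReal_prod]
  nonneg f := Finset.prod_nonneg fun k _ => (h k).nonneg _
  hasSum := by
    rw [← Complex.hasSum_ofReal, Complex.ofReal_one,
      hasSum_ofReal_iff_tsum fun f => Finset.prod_nonneg fun k _ => (h k).nonneg _]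
    simp only [ENNReal.ofReal_prod_of_nonneg fun k _ => (h k).nonneg _]
    rw [tsum_prod_eq_prod_tsum fun k j => ENNReal.ofReal (l k j)]
    refine Finset.prod_eq_one fun k _ => (hasSum_ofReal_iff_tsum (h k).nonneg).1 ?_
    simpa using Complex.hasSum_ofReal.2 (h k).hasSum

theorem pos_of_prod_pos (hl : ∀ k j, 0 ≤ l k j) {f : ∀ k, κ k} (hf : 0 < ∏ k, l k (f k))
    (k : Fin n) : 0 < l k (f k) :=
  (hl k _).lt_of_ne' (Finset.prod_ne_zero_iff.1 hf.ne' k (Finset.mem_univ k))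

/-- Energies add over the factors, so the partition function is at most the product of the given
ones, and the mean energy is a sum over `k` in which every factor except the `k`-th contributes only
its trace. -/
theorem hasFAProperty_tensorOp (h : ∀ k, IsEigenbasis (ρ k) (b k) (l k))
    (hρ : ∀ k, HasFAProperty (ρ k)) : HasFAProperty (tensorOp ρ) := by
  choose g hg0 hgs hg using fun k => (h k).hasFAProperty_iff'.1 (hρ k)
  refine (IsEigenbasis.tensorOp h).hasFAProperty_iff'.2 ⟨fun f => ∑ k, g k (f k),
    fun f => Finset.sum_nonneg fun k _ => hg0 k _, ?_, ?_⟩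
  · simp only [Finset.mul_sum]
    refine summable_sum fun k _ => ?_
    have hf0 : ∀ f : ∀ k, κ k, 0 ≤ (∏ m, l m (f m)) * g k (f k) := fun f =>
      mul_nonneg (Finset.prod_nonneg fun m _ => (h m).nonneg _) (hg0 k _)
    rw [summable_iff_tsum_ofReal_ne_top hf0]
    -- The energy is absorbed into the `k`-th factor, so that the sum over `f` factorises.
    have heq : ∀ f : ∀ k, κ k, ENNReal.ofReal ((∏ m, l m (f m)) * g k (f k)) =
        ∏ m, ENNReal.ofReal (l m (f m) * if m = k then g m (f m) else 1) := fun f => by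
      rw [← ENNReal.ofReal_prod_of_nonneg, Finset.prod_mul_distrib, Finset.prod_ite_eq']
      · simp
      · intro m _
        split_ifs
        exacts [mul_nonneg ((h m).nonneg _) (hg0 m _), mul_nonneg ((h m).nonneg _) zero_le_one]
    simp only [heq]
    rw [tsum_prod_eq_prod_tsum fun m j =>
      ENNReal.ofReal (l m j * if m = k then g m j else 1)]
    refine ENNReal.prod_ne_top fun m _ => ?_
    by_cases hm : m = k
    · simp only [hm, if_true]
      exact (summable_iff_tsum_ofReal_ne_top fun j =>
        mul_nonneg ((h m).nonneg _) (hg0 m _)).1 (hgs m)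
    · simp only [hm, if_false, mul_one]
      exact (summable_iff_tsum_ofReal_ne_top (h m).nonneg).1 (h m).hasSum.summable
  · refine (SubexpRoot.prod Finset.univ fun k _ => hg k).mono fun β _ => ?_
    rw [← partitionFn_sum fun k (j : {j // 0 < l k j}) => g k j]
    let φ : {f : ∀ k, κ k // 0 < ∏ k, l k (f k)} → ∀ k, {j // 0 < l k j} := fun f k =>
      ⟨f.1 k, pos_of_prod_pos (fun k => (h k).nonneg) f.2 k⟩
    have hφ : Function.Injective φ := fun f f' hff => Subtype.ext <| funext fun k =>
      congrArg Subtype.val (congrFun hff k)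
    exact partitionFn_comp_le (fun x : ∀ k, {j // 0 < l k j} => ∑ k, g k (x k)) hφ β

theorem IsEigenbasis.exists_pos {E : Type*} [NormedAddCommGroup E] [InnerProductSpace ℂ E]
    {κ : Type*} {ρ : E →L[ℂ] E} {b : HilbertBasis κ ℂ E} {l : κ → ℝ}
    (h : IsEigenbasis ρ b l) : ∃ j, 0 < l j := by
  by_contra! hall
  have h0 : l = 0 := funext fun j => le_antisymm (hall j) (h.nonneg j)
  have := h.hasSum
  rw [h0] at this
  exact zero_ne_one (hasSum_zero.unique this)

/-- Freezing the other coordinates at indices with positive eigenvalues gives a slice on which the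
eigenvalues of the product are `l k j` times a constant `C > 0`; the energies are restricted to it.
-/
theorem hasFAProperty_of_tensorOp (h : ∀ k, IsEigenbasis (ρ k) (b k) (l k))
    (hρ : HasFAProperty (QState.tensorOp ρ)) (k : Fin n) : HasFAProperty (ρ k) := by
  obtain ⟨g, hg0, hgs, hg⟩ := (IsEigenbasis.tensorOp h).hasFAProperty_iff'.1 hρ
  choose f hf using fun m => (h m).exists_pos
  let x : κ k → ∀ m, κ m := Function.update f k
  have hx : Function.Injective x := Function.update_injective f k
  let C : ℝ := ∏ m ∈ Finset.univ.erase k, l m (f m)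
  have hC : 0 < C := Finset.prod_pos fun m _ => hf m
  have hprod : ∀ j, ∏ m, l m (x j m) = l k j * C := fun j => by
    rw [← Finset.mul_prod_erase _ _ (Finset.mem_univ k)]
    congr 1
    · simp [x]
    · refine Finset.prod_congr rfl fun m hm => ?_
      simp [x, Function.update_of_ne (Finset.ne_of_mem_erase hm)]
  refine (h k).hasFAProperty_iff'.2 ⟨fun j => g (x j), fun j => hg0 _, ?_, ?_⟩
  · refine ((hgs.comp_injective hx).mul_left C⁻¹).congr fun j => ?_
    simp only [Function.comp, hprod]
    field_simp
  · refine hg.mono fun β _ => ?_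
    let φ : {j // 0 < l k j} → {f : ∀ m, κ m // 0 < ∏ m, l m (f m)} := fun j =>
      ⟨x j, by rw [hprod]; exact mul_pos j.2 hC⟩
    have hφ : Function.Injective φ := fun j j' hjj =>
      Subtype.ext (hx (congrArg Subtype.val hjj))
    exact partitionFn_comp_le
      (fun f : {f : ∀ m, κ m // 0 < ∏ m, l m (f m)} => g f) hφ β

theorem tensorOp_mem_FAStates_iff {ρ : ∀ k, H k →L[ℂ] H k} (hρ : ∀ k, IsState (ρ k)) :
    tensorOp ρ ∈ FAStates (HilbertTensor H) ↔ ∀ k, ρ k ∈ FAStates (H k) := by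
  choose κ b l h using fun k => (hρ k).exists_eigenbasis
  exact ⟨fun hT k => ⟨hρ k, hasFAProperty_of_tensorOp h hT.2 k⟩,
    fun hk => ⟨(IsEigenbasis.tensorOp h).isState, hasFAProperty_tensorOp h fun k => (hk k).2⟩⟩

end ProductStates

/-! ### States with FA marginals -/

section Marginals

variable {n : ℕ} {H : Fin n → Type u} [∀ k, NormedAddCommGroup (H k)]
  [∀ k, InnerProductSpace ℂ (H k)] [∀ k, CompleteSpace (H k)] {κ : Fin n → Type u}

/-- The product vector `x ⊗ e_f`, with `x` in position `k` and basis vectors in the other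
positions. -/
def insertVec (b : ∀ k, HilbertBasis (κ k) ℂ (H k)) (k : Fin n)
    (f : ∀ i : {i // i ≠ k}, κ i) (x : H k) : ∀ i, H i :=
  Function.update (fun i => if h : i = k then 0 else b i (f ⟨i, h⟩)) k x

theorem insertAt_apply (k : Fin n) (f : ∀ i : {i // i ≠ k}, StdIndex (H i)) (x : H k) :
    insertAt k f x = tprod (insertVec (fun i => stdBasis (H i)) k f x) := rfl

theorem tensorBasis_piSplitAt (b : ∀ k, HilbertBasis (κ k) ℂ (H k)) (k : Fin n) (j : κ k)
    (f : ∀ i : {i // i ≠ k}, κ i) :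
    tensorBasis b ((Equiv.piSplitAt k κ).symm (j, f)) = tprod (insertVec b k f (b k j)) := by
  rw [tensorBasis_apply]
  congr 1
  funext i
  by_cases h : i = k
  · subst h
    simp [Equiv.piSplitAt, insertVec]
  · simp [Equiv.piSplitAt, h, insertVec]

/-- The projection `|x⟩⟨x|` in position `k`, and the identity in the other positions. -/
def projAt (k : Fin n) (x : H k) : HilbertTensor H →L[ℂ] HilbertTensor H :=
  tensorOp (Function.update (fun i => ContinuousLinearMap.id ℂ (H i)) k
    ((innerSL ℂ x).smulRight x))

theorem projAt_tensorBasis (b : ∀ k, HilbertBasis (κ k) ℂ (H k)) (k : Fin n) (x : H k)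
    (j : κ k) (f : ∀ i : {i // i ≠ k}, κ i) :
    projAt k x (tensorBasis b ((Equiv.piSplitAt k κ).symm (j, f))) =
      ⟪x, b k j⟫_ℂ • tprod (insertVec b k f x) := by
  rw [tensorBasis_piSplitAt, projAt, tensorOp_tprod]
  have h1 : (fun i => Function.update (fun i => ContinuousLinearMap.id ℂ (H i)) k
      ((innerSL ℂ x).smulRight x) i (insertVec b k f (b k j) i)) =
      Function.update (insertVec b k f x) k (⟪x, b k j⟫_ℂ • x) := by
    funext i
    by_cases h : i = k
    · subst h
      simp [insertVec]
    · simp [insertVec, h]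
  rw [h1, ContinuousMultilinearMap.map_update_smul]
  congr 2
  simp [insertVec]

/-- The right side is a squared Hilbert--Schmidt norm, so the partial trace on the left does not
depend on the product basis. The equality holds because `projAt k x` multiplies `x ⊗ e_f` by `⟨x, b
k j⟩`, and these coefficients have square sum `‖x‖² = 1`. -/
theorem tsum_insertVec_eq (b : ∀ k, HilbertBasis (κ k) ℂ (H k)) {F : Type*}
    [NormedAddCommGroup F] [InnerProductSpace ℂ F]
    (S : HilbertTensor H →L[ℂ] F) (k : Fin n) {x : H k} (hx : ‖x‖ = 1) :
    ∑' f, ENNReal.ofReal (‖S (tprod (insertVec b k f x))‖ ^ 2) =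
      ∑' p, ENNReal.ofReal (‖(S ∘L projAt k x) (tensorBasis b p)‖ ^ 2) := by
  rw [← (Equiv.piSplitAt k κ).symm.tsum_eq, ENNReal.tsum_prod']
  simp only [ContinuousLinearMap.comp_apply, projAt_tensorBasis, map_smul, norm_smul, mul_pow,
    ENNReal.ofReal_mul (sq_nonneg ‖⟪x, b k _⟫_ℂ‖), ENNReal.tsum_mul_left]
  rw [ENNReal.tsum_mul_right]
  simp only [norm_inner_symm x]
  rw [tsum_ofReal_norm_inner_sq, hx]
  simp

/-- Matrix elements of the marginal, computed in an arbitrary product basis. -/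
theorem ofReal_re_inner_marginal (b : ∀ k, HilbertBasis (κ k) ℂ (H k))
    {ρ S : HilbertTensor H →L[ℂ] HilbertTensor H} (hρ : IsState ρ)
    (hS : ∀ x, ⟪x, ρ x⟫_ℂ = ((‖S x‖ ^ 2 : ℝ) : ℂ)) (k : Fin n) {x : H k} (hx : ‖x‖ = 1) :
    ENNReal.ofReal (⟪x, marginal ρ k x⟫_ℂ).re =
      ∑' f, ENNReal.ofReal (‖S (tprod (insertVec b k f x))‖ ^ 2) := by
  rw [tsum_insertVec_eq b S k hx,
    tsum_norm_sq_eq (tensorBasis b) (tensorBasis fun i => stdBasis (H i)),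
    ← tsum_insertVec_eq (fun i => stdBasis (H i)) S k hx]
  have h1 := (summable_marginal hρ k).hasSum
  have h2 : HasSum (fun f => ((‖S (insertAt k f x)‖ ^ 2 : ℝ) : ℂ)) ⟪x, marginal ρ k x⟫_ℂ := by
    have h3 := h1.mapL ((innerSL ℂ x) ∘L (ContinuousLinearMap.apply ℂ (H k) x))
    refine HasSum.congr_fun h3 fun f => ?_
    rw [← hS, ← ContinuousLinearMap.adjoint_inner_right]
    rfl
  have h4 := Complex.hasSum_re h2
  simp only [Complex.ofReal_re, insertAt_apply] at h4
  rw [← h4.tsum_eq, ENNReal.ofReal_tsum_of_nonneg (fun _ => sq_nonneg _) h4.summable]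

/-- The numbers `⟨e_f, ρ e_f⟩ = ‖S e_f‖²` form a joint distribution on multi-indices whose `k`-th
marginal is `l k`; here a function of the `k`-th coordinate is averaged. -/
theorem tsum_tensorBasis_mul {b : ∀ k, HilbertBasis (κ k) ℂ (H k)} {l : ∀ k, κ k → ℝ}
    {ρ S : HilbertTensor H →L[ℂ] HilbertTensor H} (hρ : IsState ρ)
    (hS : ∀ x, ⟪x, ρ x⟫_ℂ = ((‖S x‖ ^ 2 : ℝ) : ℂ)) {k : Fin n}
    (h : IsEigenbasis (marginal ρ k) (b k) (l k)) (w : κ k → ℝ≥0∞) :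
    ∑' f, ENNReal.ofReal (‖S (tensorBasis b f)‖ ^ 2) * w (f k) =
      ∑' j, ENNReal.ofReal (l k j) * w j := by
  rw [← (Equiv.piSplitAt k κ).symm.tsum_eq, ENNReal.tsum_prod']
  refine tsum_congr fun j => ?_
  have h1 := ofReal_re_inner_marginal b hρ hS k ((b k).orthonormal.1 j)
  rw [h.inner_apply_self, Complex.ofReal_re] at h1
  rw [h1, ← ENNReal.tsum_mul_right]
  refine tsum_congr fun f => ?_
  rw [tensorBasis_piSplitAt]
  simp [Equiv.piSplitAt]

theorem mem_FAStates_of_marginal {ρ : HilbertTensor H →L[ℂ] HilbertTensor H} (hρ : IsState ρ)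
    (hm : ∀ k, marginal ρ k ∈ FAStates (H k)) : ρ ∈ FAStates (HilbertTensor H) := by
  choose κ b l h using fun k => (hm k).1.exists_eigenbasis
  choose g hg0 hgs hg using fun k => (h k).hasFAProperty_iff'.1 (hm k).2
  obtain ⟨S, hSa, -, hS⟩ := exists_selfAdjoint_sqrt hρ.1
  let ψ : (∀ k, {j // 0 < l k j}) → ∀ k, κ k := fun x k => x k
  have hψ : Function.Injective ψ := fun x y hxy => funext fun k => Subtype.ext (congrFun hxy k)
  -- A multi-index with a zero eigenvalue in some coordinate has probability `0`, seen by averaging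
  -- the indicator of that coordinate's value. Such vectors drop out of the ensemble.
  have hzero : ∀ f, f ∉ Set.range ψ → S (tensorBasis b f) = 0 := by
    intro f hf
    obtain ⟨k, hk⟩ : ∃ k, ¬ 0 < l k (f k) := by
      by_contra! hall
      exact hf ⟨fun k => ⟨f k, hall k⟩, rfl⟩
    classical
    have h1 := tsum_tensorBasis_mul hρ hS (h k) fun j => if j = f k then 1 else 0
    have h2 : ∑' j, ENNReal.ofReal (l k j) * (if j = f k then 1 else 0) = 0 := by
      refine ENNReal.tsum_eq_zero.2 fun j => ?_
      split_ifs with hj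
      · rw [hj, ENNReal.ofReal_eq_zero.2 (not_lt.1 hk), zero_mul]
      · rw [mul_zero]
    have h3 := ENNReal.tsum_eq_zero.1 (h1.trans h2) f
    simp only [if_true, mul_one, ENNReal.ofReal_eq_zero] at h3
    exact norm_eq_zero.1 (pow_eq_zero_iff two_ne_zero |>.1 (le_antisymm h3 (sq_nonneg _)))
  refine ⟨hρ, hasFAProperty_of_ensemble hρ (v := fun x => S (tensorBasis b (ψ x)))
    (g := fun x => ∑ k, g k (x k)) (fun x => Finset.sum_nonneg fun k _ => hg0 k _) ?_ ?_ ?_⟩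
  · intro y
    rw [hS, Complex.ofReal_re]
    -- Parseval for `√ρ y`, which amounts to `ρ = ∑ |√ρ e_f⟩⟨√ρ e_f|`.
    have h1 := hasSum_norm_inner_sq (tensorBasis b) (S y)
    rw [← hψ.hasSum_iff] at h1
    · refine h1.congr_fun fun x => ?_
      rw [Function.comp_apply, ← ContinuousLinearMap.adjoint_inner_left, hSa]
    · intro f hf
      rw [← ContinuousLinearMap.adjoint_inner_left, hSa, hzero f hf]
      simp
  · simp only [Finset.mul_sum]
    refine summable_sum fun k _ => ?_
    have h1 : Summable fun f : ∀ k, κ k => ‖S (tensorBasis b f)‖ ^ 2 * g k (f k) := by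
      rw [summable_iff_tsum_ofReal_ne_top fun f => mul_nonneg (sq_nonneg _) (hg0 k _)]
      simp only [ENNReal.ofReal_mul (sq_nonneg _)]
      rw [tsum_tensorBasis_mul hρ hS (h k) fun j => ENNReal.ofReal (g k j)]
      simp only [← ENNReal.ofReal_mul ((h k).nonneg _)]
      exact (summable_iff_tsum_ofReal_ne_top fun j =>
        mul_nonneg ((h k).nonneg _) (hg0 k _)).1 (hgs k)
    exact h1.comp_injective hψ
  · refine (SubexpRoot.prod Finset.univ fun k _ => hg k).mono fun β _ => le_of_eq ?_
    exact partitionFn_sum (fun k (j : {j // 0 < l k j}) => g k j) β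

end Marginals

end QState

end

theorem proposition1 :
    (∀ (H : Type u) [NormedAddCommGroup H] [InnerProductSpace ℂ H] [CompleteSpace H]
        [TopologicalSpace.SeparableSpace H],
      Convex ℝ (QState.FAStates H)) ∧
    (∀ (n : ℕ) (H : Fin n → Type u) [∀ k, NormedAddCommGroup (H k)]
        [∀ k, InnerProductSpace ℂ (H k)] [∀ k, CompleteSpace (H k)]
        [∀ k, TopologicalSpace.SeparableSpace (H k)],
      (∀ ρ : QState.HilbertTensor H →L[ℂ] QState.HilbertTensor H, QState.IsState ρ →
        (∀ k, QState.marginal ρ k ∈ QState.FAStates (H k)) →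
          ρ ∈ QState.FAStates (QState.HilbertTensor H)) ∧
      (∀ ρ : ∀ k, H k →L[ℂ] H k, (∀ k, QState.IsState (ρ k)) →
        (QState.tensorOp ρ ∈ QState.FAStates (QState.HilbertTensor H) ↔
          ∀ k, ρ k ∈ QState.FAStates (H k)))) := by
  refine ⟨fun H _ _ _ _ => QState.convex_FAStates, fun n H _ _ _ _ => ⟨fun ρ hρ hm => ?_,
    fun ρ hρ => QState.tensorOp_mem_FAStates_iff hρ⟩⟩
  exact QState.mem_FAStates_of_marginal hρ hm
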